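/- Let $q$ be a prime power and let $m,m_1,m_2$ be positive integers with $m_1\mid m$, $m_2\mid m$, $\gcd(m_1,m_2)=1$ and $\gcd(m_2,q-1)=2$. Let $\mathrm{Tr}_{q^{m_i}/q}:\mathbb{F}_{q^{m_i}}\to\mathbb{F}_q$ be the trace and $\mathrm{N}_{q^m/q^{m_i}}:\mathbb{F}_{q^m}\to\mathbb{F}_{q^{m_i}}$ the norm. Put $$D=\{x\in\mathbb{F}_{q^m}:\mathrm{Tr}_{q^{m_2}/q}(\mathrm{N}_{q^m/q^{m_2}}(x))=0\},$$ $$\overline{\mathcal{C}_D}=\{(\mathrm{Tr}_{q^{m_1}/q}(b\,\mathrm{N}_{q^m/q^{m_1}}(x))+c)_{x\in D}: b\in\mathbb{F}_{q^{m_1}},\ c\in\mathbb{F}_q\}\subseteq\mathbb{F}_q^{D}.$$ Then $\overline{\mathcal{C}_D}$ is a linear code over $\mathbb{F}_q$ of length $$n=\frac{(q^m-1)(q^{m_2}-q)}{q(q^{m_2}-1)}+1$$ and dimension $m_1+1$, and its weight distribution is as follows (if two of the listed weights are equal, their frequencies are added): - weight $0$ with frequency $1$; - weight $n$ with frequency $q-1$;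 - weight $\dfrac{q^{m_1-1}(q^m-1)(q-1)(q^{m_2-1}-1)}{(q^{m_1}-1)(q^{m_2}-1)}$ with frequency $q^{m_1}-1$; - weight $\dfrac{(q^m-1)\left((q^{m_2-1}-1)(q^{m_1}-q^{m_1-1}-1)+(q-1)q^{(m_1+m_2-3)/2}\right)}{(q^{m_1}-1)(q^{m_2}-1)}+1$ with frequency $\dfrac{(q^{m_1}-1)(q-1)}{2}$; - weight $\dfrac{(q^m-1)\left((q^{m_2-1}-1)(q^{m_1}-q^{m_1-1}-1)-(q-1)q^{(m_1+m_2-3)/2}\right)}{(q^{m_1}-1)(q^{m_2}-1)}+1$ with frequency $\dfrac{(q^{m_1}-1)(q-1)}{2}$. If $(m_1,m_2)\neq(1,2)$, then $\overline{\mathcal{C}_D}$ is a four-weight code, that is, its nonzero codewords have exactly four different Hamming weights. If moreover $m_1\ge 2$, $m_2\ge 2$, $m_1+m_2\ge 5$ and $q$ is odd, then $\overline{\mathcal{C}_D}$ is $q$-divisible (every weight is divisible by $q$) and self-orthogonal (contained in its dual with respect to the standard inner product). -/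

import Mathlib

/-- `A_j`: the number of codewords of Hamming weight `j` in the linear code `C ⊆ F ^ ι`. -/
noncomputable def weightCount {ι F : Type*} [Fintype ι] [Field F] [DecidableEq F]
    (C : Submodule F (ι → F)) (j : ℕ) : ℕ :=
  Set.ncard {u : ι → F | u ∈ C ∧ hammingNorm u = j}

/-- `C` is a `t`-weight code: exactly `t` of the numbers `A_1, …, A_n` are nonzero,
where `n` is the length of `C`. -/
def IsTWeightCode {ι F : Type*} [Fintype ι] [Field F] [DecidableEq F]
    (t : ℕ) (C : Submodule F (ι → F)) : Prop :=
  Set.ncard {j : ℕ | 1 ≤ j ∧ j ≤ Fintype.card ι ∧ weightCount C j ≠ 0} = t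

/-- `C` is `Δ`-divisible: `Δ > 1` divides the weight of every codeword. -/
def IsDivisibleCode {ι F : Type*} [Fintype ι] [Field F] [DecidableEq F]
    (Δ : ℕ) (C : Submodule F (ι → F)) : Prop :=
  1 < Δ ∧ ∀ u ∈ C, Δ ∣ hammingNorm u

/-- The dual code with respect to the standard inner product of `F ^ ι`. -/
def dualCode {ι F : Type*} [Fintype ι] [Field F]
    (C : Submodule F (ι → F)) : Submodule F (ι → F) where
  carrier := {u | ∀ v ∈ C, ∑ i, u i * v i = 0}
  zero_mem' := by
    intro v _
    simp
  add_mem' := by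
    intro a b ha hb v hv
    simp [add_mul, Finset.sum_add_distrib, ha v hv, hb v hv]
  smul_mem' := by
    intro r a ha v hv
    simp [mul_assoc, ← Finset.mul_sum, ha v hv]

/-- `C` is self-orthogonal: it is contained in its dual. -/
def IsSelfOrthogonalCode {ι F : Type*} [Fintype ι] [Field F]
    (C : Submodule F (ι → F)) : Prop :=
  C ≤ dualCode C

/-- The defining set `D = {x ∈ K : Tr_{K₂/F}(N_{K/K₂}(x)) = 0}`. -/
noncomputable def definingSet (F K₂ K : Type*) [Field F] [DecidableEq F] [Field K₂] [Field K]
    [Fintype K] [Algebra F K₂] [Algebra K₂ K] : Finset K :=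
  Finset.univ.filter fun x : K => Algebra.trace F K₂ (Algebra.norm K₂ x) = 0

/-- The augmented code `{(Tr_{K₁/F}(b N_{K/K₁}(x)) + c)_{x ∈ D} : b ∈ K₁, c ∈ F}`,
with coordinates indexed by a set `D ⊆ K`. -/
def augmentedCode (F K₁ : Type*) {K : Type*} [Field F] [Field K₁] [Field K]
    [Algebra F K₁] [Algebra K₁ K] (D : Finset K) : Submodule F (D → F) where
  carrier := {u | ∃ (b : K₁) (c : F),
    u = fun x : D => Algebra.trace F K₁ (b * Algebra.norm K₁ (x : K)) + c}
  zero_mem' := ⟨0, 0, by ext x; simp⟩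
  add_mem' := by
    rintro _ _ ⟨b, c, rfl⟩ ⟨b', c', rfl⟩
    refine ⟨b + b', c + c', ?_⟩
    ext x
    simp only [Pi.add_apply, add_mul, map_add]
    ring
  smul_mem' := by
    rintro r _ ⟨b, c, rfl⟩
    refine ⟨r • b, r * c, ?_⟩
    ext x
    simp only [Pi.smul_apply, smul_eq_mul, smul_mul_assoc, map_smul]
    ring

/-! Write T_L(c) for `traceCharSum L c`, with χ the quadratic character of F. The gcd conditions
force q odd, m₁ odd and m₂ even. Everything reduces to counting the x in D with Tr(b N(x)) = c. The
pair of norms maps Kˣ onto the pairs (y, z) in K₁ˣ × K₂ˣ with equal norm in F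
(`normPair_surjective`), with fibres of one common size M. So the count is M times the number of
such pairs with Tr(z) = 0 and Tr(by) = c. Scaling z by t in Fˣ preserves trace zero and multiplies
the norm by t^m₂. Since gcd(m₂, q - 1) = 2, every square is an m₂-th power, so the number of
trace-zero z of norm a depends only on χ(a). Orthogonality of 1 and χ then expresses it through
T_{K₂}(0) (`mul_normTraceCount`), and summation over y brings in χ(N(b)) T_{K₁}(c). The sum of
T_L(c)ψ(c) over c is a Gauss sum on L, whose square is known. This gives T_{K₁}(1)² and T_{K₂}(0)²,
hence the weights up to one global sign δ (`exists_weights`). The sign does not affect the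
distribution: for fixed b ≠ 0, χ(c) takes both signs equally often (`weightCount_eq_of_weights`).
Distinctness of the weights and divisibility by q are integer arithmetic. Self-orthogonality follows
from divisibility and the presence of the constant words, by polarization
(`isSelfOrthogonalCode_of_weights`). -/

/-- The multiplicative character `χ ∘ N_{L/F}`. -/
noncomputable def MulChar.compNorm {F : Type*} (L : Type*) {R : Type*} [Field F] [Field L]
    [Algebra F L] [FiniteDimensional F L] [CommRing R] (χ : MulChar F R) : MulChar L R where
  toFun y := χ (Algebra.norm F y)
  map_one' := by simp
  map_mul' x y := by simp
  map_nonunit' y hy := by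
    have : y = 0 := by simpa using hy
    simp [this]

/-- The additive character `ψ ∘ Tr_{L/F}`. -/
noncomputable def AddChar.compTrace {F : Type*} (L : Type*) {R : Type*} [Field F] [Field L]
    [Algebra F L] [CommRing R] (ψ : AddChar F R) : AddChar L R :=
  ψ.compAddMonoidHom (Algebra.trace F L).toAddMonoidHom

/-- `∑ χ(N(y))` over all `y` in `L` with `Tr(y) = c`, for the quadratic character `χ` of `F`. -/
noncomputable def traceCharSum {F : Type*} (L : Type*) [Field F] [Fintype F] [DecidableEq F]
    [Field L] [Fintype L] [Algebra F L] (c : F) : ℤ :=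
  ∑ y : L, if Algebra.trace F L y = c then quadraticChar F (Algebra.norm F y) else 0

theorem Fintype.sum_units_eq_sub {L A : Type*} [Field L] [Fintype L] [AddCommGroup A]
    [Fintype Lˣ] (f : L → A) : ∑ u : Lˣ, f u = (∑ y, f y) - f 0 := by
  classical
  rw [eq_sub_iff_add_eq, ← Finset.sum_erase_add _ _ (Finset.mem_univ (0 : L))]
  congr 1
  refine Finset.sum_bij (fun u _ => (u : L)) (by simp) (fun _ _ _ _ h => Units.ext h) ?_
    (fun _ _ => rfl)
  intro y hy
  exact ⟨Units.mk0 y (by simpa using hy), by simp, rfl⟩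

/-- Bézout writes 2 as a combination of k and the group order, and the order contributes a trivial
power. -/
theorem exists_pow_eq_sq_of_gcd_eq_two {G : Type*} [Group G] [Fintype G] {k : ℕ}
    (h : Nat.gcd k (Fintype.card G) = 2) (s : G) : ∃ t : G, t ^ k = s ^ 2 := by
  refine ⟨s ^ (Nat.gcdA k (Fintype.card G)), ?_⟩
  have hb := Nat.gcd_eq_gcd_ab k (Fintype.card G)
  rw [h] at hb
  calc (s ^ (Nat.gcdA k (Fintype.card G))) ^ k
      = s ^ ((k : ℤ) * Nat.gcdA k (Fintype.card G)) := by
        rw [mul_comm, zpow_mul, zpow_natCast]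
    _ = s ^ ((k : ℤ) * Nat.gcdA k (Fintype.card G)
          + (Fintype.card G : ℤ) * Nat.gcdB k (Fintype.card G)) := by
        rw [zpow_add, zpow_mul s (Fintype.card G : ℤ), zpow_natCast, pow_card_eq_one, one_zpow,
          mul_one]
    _ = s ^ 2 := by rw [← hb]; norm_cast

/-! ### Quadratic character sums over trace fibres -/

section SingleExtension

set_option linter.unusedSectionVars false

variable {F L : Type*} [Field F] [Fintype F] [DecidableEq F] [Field L] [Fintype L] [Algebra F L]

theorem quadraticChar_norm_algebraMap_mul (t : F) (y : L) :
    quadraticChar F (Algebra.norm F (algebraMap F L t * y))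
      = quadraticChar F t ^ Module.finrank F L * quadraticChar F (Algebra.norm F y) := by
  rw [map_mul, Algebra.norm_algebraMap, map_mul, map_pow]

theorem trace_algebraMap_mul (t : F) (y : L) :
    Algebra.trace F L (algebraMap F L t * y) = t * Algebra.trace F L y := by
  rw [← Algebra.smul_def, map_smul, smul_eq_mul]

theorem traceCharSum_mul {t : F} (ht : t ≠ 0) (c : F) :
    traceCharSum L (t * c) = quadraticChar F t ^ Module.finrank F L * traceCharSum L c := by
  have ht' : algebraMap F L t ≠ 0 := by simpa using ht
  unfold traceCharSum
  rw [← (mulLeft_bijective₀ _ ht').sum_comp, Finset.mul_sum]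
  refine Finset.sum_congr rfl fun y _ => ?_
  rw [quadraticChar_norm_algebraMap_mul, trace_algebraMap_mul]
  simp [ht]

theorem card_trace_eq (c : F) :
    Fintype.card F * (Finset.univ.filter fun y : L => Algebra.trace F L y = c).card
      = Fintype.card F ^ Module.finrank F L := by
  have hs : ∀ c : F, c ∈ Set.range (Algebra.trace F L) := fun c => Algebra.trace_surjective F L c
  rw [← Module.card_eq_pow_finrank (K := F) (V := L), ← Finset.card_univ (α := L),
    Finset.card_eq_sum_card_fiberwise (f := Algebra.trace F L) (s := Finset.univ)
      (t := Finset.univ) (by simp),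
    Finset.sum_congr rfl fun c' _ =>
      AddMonoidHom.card_fiber_eq_of_mem_range (Algebra.trace F L) (hs c') (hs c)]
  simp

theorem card_trace_eq' (c : F) :
    (Finset.univ.filter fun y : L => Algebra.trace F L y = c).card
      = Fintype.card F ^ (Module.finrank F L - 1) := by
  have h := card_trace_eq (L := L) c
  obtain ⟨k, hk⟩ := Nat.exists_eq_add_one.mpr (Module.finrank_pos (R := F) (M := L))
  rw [hk, pow_succ', Nat.mul_right_inj Fintype.card_ne_zero] at h
  rw [h, hk, Nat.add_sub_cancel]

/-- The norm is surjective, so χ ∘ N is a nontrivial character. -/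
theorem sum_quadraticChar_norm (hF : ringChar F ≠ 2) :
    ∑ y : L, quadraticChar F (Algebra.norm F y) = 0 := by
  obtain ⟨a, ha⟩ := quadraticChar_exists_neg_one hF
  obtain ⟨y, rfl⟩ := FiniteField.norm_surjective F L a
  refine MulChar.sum_eq_zero_of_ne_one (χ := (quadraticChar F).compNorm L) fun h => ?_
  have h1 : (quadraticChar F).compNorm L y = -1 := ha
  have hy : y ≠ 0 := by rintro rfl; simp at ha
  rw [h, MulChar.one_apply (by simpa using hy)] at h1
  norm_num at h1

theorem sum_traceCharSum (hF : ringChar F ≠ 2) : ∑ c : F, traceCharSum L c = 0 := by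
  unfold traceCharSum
  rw [Finset.sum_comm]
  simpa using sum_quadraticChar_norm hF

/-- Grouping y by its trace identifies the sum with the Gauss sum of χ ∘ N against ψ ∘ Tr on L. Both
characters are nontrivial and the first is quadratic, so its square is χ(N(-1))|L|. -/
theorem sum_traceCharSum_mul_addChar_sq (hF : ringChar F ≠ 2) {ψ : AddChar F ℂ} (hψ : ψ ≠ 1) :
    (∑ c : F, (traceCharSum L c : ℂ) * ψ c) ^ 2
      = (quadraticChar F (-1) : ℂ) ^ Module.finrank F L * (Fintype.card L : ℂ) := by
  set χ := ((quadraticChar F).compNorm L).ringHomComp (Int.castRingHom ℂ) with hχ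
  have h1 : (∑ c : F, (traceCharSum L c : ℂ) * ψ c) = gaussSum χ (ψ.compTrace L) := by
    unfold traceCharSum gaussSum
    simp_rw [Int.cast_sum, Finset.sum_mul]
    rw [Finset.sum_comm]
    refine Finset.sum_congr rfl fun y _ => ?_
    rw [Finset.sum_eq_single (Algebra.trace F L y)]
    · simp [hχ, MulChar.compNorm, AddChar.compTrace]
    · intro b _ hb
      simp [hb.symm]
    · simp
  have hne : (quadraticChar F).compNorm L ≠ 1 := fun h => by
    classical
    have := sum_quadraticChar_norm (L := L) hF
    have h2 : ∑ y : L, (quadraticChar F).compNorm L y = 0 := this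
    rw [h, MulChar.sum_one_eq_card_units] at h2
    exact absurd h2 (by exact_mod_cast Fintype.card_ne_zero)
  have hquad : ((quadraticChar F).compNorm L).IsQuadratic := fun y =>
    quadraticChar_isQuadratic F (Algebra.norm F y)
  have hψ' : ψ.compTrace L ≠ 1 := by
    obtain ⟨c, hc⟩ := AddChar.ne_one_iff.1 hψ
    obtain ⟨y, rfl⟩ := Algebra.trace_surjective F L c
    exact AddChar.ne_one_iff.2 ⟨y, hc⟩
  rw [h1, gaussSum_sq ((MulChar.ringHomComp_ne_one_iff (RingHom.injective_int _)).mpr hne)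
    (hquad.comp _) (AddChar.IsPrimitive.of_ne_one hψ')]
  congr 1
  have : Algebra.norm F (-1 : L) = (-1) ^ Module.finrank F L := by
    simpa using Algebra.norm_algebraMap (S := L) (-1 : F)
  have h2 : χ (-1) = (quadraticChar F (Algebra.norm F (-1 : L)) : ℂ) := rfl
  rw [h2, this, map_pow, Int.cast_pow]

theorem exists_addChar_ne_one : ∃ ψ : AddChar F ℂ, ψ ≠ 1 :=
  ⟨_, fun h => AddChar.FiniteField.primitiveChar_to_Complex_isPrimitive F one_ne_zero
    (by rw [AddChar.mulShift_one]; exact h)⟩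

theorem traceCharSum_eq_of_odd (hodd : Odd (Module.finrank F L)) (c : F) (hc : c ≠ 0) :
    traceCharSum L c = quadraticChar F c * traceCharSum L (1 : F) := by
  have h := traceCharSum_mul (L := L) hc 1
  rw [mul_one] at h
  rw [h]
  obtain h | h := quadraticChar_dichotomy hc <;> simp [h, hodd.neg_one_pow]

theorem traceCharSum_zero_of_odd (hF : ringChar F ≠ 2) (hodd : Odd (Module.finrank F L)) :
    traceCharSum L (0 : F) = 0 := by
  obtain ⟨t, ht⟩ := quadraticChar_exists_neg_one hF
  have ht0 : t ≠ 0 := by rintro rfl; simp at ht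
  have h := traceCharSum_mul (L := L) ht0 0
  -- Scaling by a nonresidue fixes 0 but changes the sign of the sum in odd degree.
  rw [mul_zero, ht, hodd.neg_one_pow] at h
  linarith

/-- In odd degree T_L(c) = χ(c) T_L(1), so the Gauss sum on L is T_L(1) times the one on F;
comparing the two squares isolates T_L(1)². -/
theorem traceCharSum_one_sq_of_odd (hF : ringChar F ≠ 2) (hodd : Odd (Module.finrank F L)) :
    traceCharSum L (1 : F) ^ 2 = (Fintype.card F : ℤ) ^ (Module.finrank F L - 1) := by
  obtain ⟨ψ, hψ⟩ := exists_addChar_ne_one (F := F)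
  have hL := sum_traceCharSum_mul_addChar_sq (L := L) hF hψ
  have hq := gaussSum_sq (χ := (quadraticChar F).ringHomComp (Int.castRingHom ℂ))
    ((MulChar.ringHomComp_ne_one_iff (RingHom.injective_int _)).mpr (quadraticChar_ne_one hF))
    ((quadraticChar_isQuadratic F).comp _) (AddChar.IsPrimitive.of_ne_one hψ)
  have hs : (∑ c : F, (traceCharSum L c : ℂ) * ψ c)
      = (traceCharSum L (1 : F) : ℂ)
        * gaussSum ((quadraticChar F).ringHomComp (Int.castRingHom ℂ)) ψ := by
    unfold gaussSum
    rw [Finset.mul_sum]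
    refine Finset.sum_congr rfl fun c _ => ?_
    by_cases hc : c = 0
    · subst hc
      simp [traceCharSum_zero_of_odd hF hodd]
    · rw [traceCharSum_eq_of_odd hodd c hc]
      simp
      ring
  rw [hs, mul_pow, hq] at hL
  obtain ⟨k, hk⟩ := Nat.exists_eq_add_one.mpr (Module.finrank_pos (R := F) (M := L))
  have hcard : Fintype.card L = Fintype.card F ^ (k + 1) := by
    rw [← hk]; exact Module.card_eq_pow_finrank
  have hm1 : quadraticChar F (-1) ^ Module.finrank F L = quadraticChar F (-1) := by
    obtain h | h := quadraticChar_dichotomy (F := F) (a := -1) (by simp) <;>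
      simp [h, hodd.neg_one_pow]
  have hm1' : quadraticChar F (-1) ≠ 0 := by
    rw [Ne, quadraticChar_eq_zero_iff]; simp
  have hL' : traceCharSum L (1 : F) ^ 2 * (quadraticChar F (-1) * Fintype.card F)
      = quadraticChar F (-1) * (Fintype.card F : ℤ) ^ (k + 1) := by
    rw [hcard, ← Int.cast_pow (quadraticChar F (-1)), hm1] at hL
    simp only [MulChar.ringHomComp_apply, eq_intCast] at hL
    exact_mod_cast hL
  have hq0 : (Fintype.card F : ℤ) ≠ 0 := by exact_mod_cast Fintype.card_ne_zero
  rw [hk, Nat.add_sub_cancel]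
  refine mul_right_cancel₀ (mul_ne_zero hm1' hq0) ?_
  rw [hL']
  ring

/-- In even degree T_L is constant off 0, so its sum against ψ collapses to T_L(0) - T_L(1). The
relation T_L(0) + (q - 1)T_L(1) = 0 then determines T_L(0)². -/
theorem traceCharSum_zero_sq_of_even (hF : ringChar F ≠ 2) {k : ℕ}
    (hk : Module.finrank F L = k + 2) (heven : Even k) :
    traceCharSum L (0 : F) ^ 2 = ((Fintype.card F : ℤ) - 1) ^ 2 * (Fintype.card F : ℤ) ^ k := by
  obtain ⟨ψ, hψ⟩ := exists_addChar_ne_one (F := F)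
  have hL := sum_traceCharSum_mul_addChar_sq (L := L) hF hψ
  have hev : Even (Module.finrank F L) := by rw [hk]; exact heven.add (by decide)
  have hconst : ∀ c : F, traceCharSum L c
      = traceCharSum L (1 : F)
        + if c = 0 then traceCharSum L (0 : F) - traceCharSum L (1 : F) else 0 := by
    intro c
    by_cases hc : c = 0
    · simp [hc]
    · have h := traceCharSum_mul (L := L) hc 1
      rw [mul_one] at h
      rw [h, if_neg hc]
      obtain h | h := quadraticChar_dichotomy hc <;> simp [h, hev.neg_one_pow]
  have h0 := sum_traceCharSum (L := L) hF
  have hs : (∑ c : F, (traceCharSum L c : ℂ) * ψ c)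
      = (traceCharSum L (0 : F) - traceCharSum L (1 : F) : ℤ) := by
    rw [Finset.sum_congr rfl fun c _ => by rw [hconst c]]
    simp only [Int.cast_add, add_mul, Finset.sum_add_distrib, ← Finset.mul_sum,
      AddChar.sum_eq_zero_of_ne_one hψ]
    rw [Finset.sum_eq_single 0 (by simp +contextual) (by simp)]
    simp
  rw [Finset.sum_congr rfl fun c _ => hconst c] at h0
  simp only [Finset.sum_add_distrib, Finset.sum_const, Finset.sum_ite_eq', Finset.mem_univ,
    if_true, Finset.card_univ, nsmul_eq_mul] at h0
  have hm1 : quadraticChar F (-1) ^ Module.finrank F L = 1 := by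
    obtain h | h := quadraticChar_dichotomy (F := F) (a := -1) (by simp) <;>
      simp [h, hev.neg_one_pow]
  have hcard : Fintype.card L = Fintype.card F ^ (k + 2) := by
    rw [← hk]; exact Module.card_eq_pow_finrank
  rw [hs, ← Int.cast_pow, ← Int.cast_pow (quadraticChar F (-1)), hm1, hcard] at hL
  have hL' : (traceCharSum L (0 : F) - traceCharSum L (1 : F)) ^ 2
      = (Fintype.card F : ℤ) ^ (k + 2) := by
    rw [Int.cast_one, one_mul] at hL
    exact_mod_cast hL
  have hq0 : (Fintype.card F : ℤ) ≠ 0 := by exact_mod_cast Fintype.card_ne_zero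
  refine mul_left_cancel₀ (pow_ne_zero 2 hq0) ?_
  set q : ℤ := (Fintype.card F : ℤ)
  set T0 := traceCharSum L (0 : F)
  set T1 := traceCharSum L (1 : F)
  have h1 : q * T0 = (q - 1) * (T0 - T1) := by linear_combination h0
  calc q ^ 2 * T0 ^ 2 = (q * T0) ^ 2 := by ring
    _ = (q - 1) ^ 2 * (T0 - T1) ^ 2 := by rw [h1]; ring
    _ = _ := by rw [hL']; ring

end SingleExtension

/-! ### The joint norm map to K₁ and K₂ -/

theorem card_sub_one_div_mul_cancel (E K : Type*) [Field E] [Field K] [Algebra E K] [Finite K] :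
    (Nat.card K - 1) / (Nat.card E - 1) * (Nat.card E - 1) = Nat.card K - 1 := by
  refine Nat.div_mul_cancel ?_
  rw [← Nat.card_units, ← Nat.card_units]
  exact Subgroup.card_dvd_of_surjective _ (FiniteField.unitsMap_norm_surjective E K)

section NormPair

variable (F K₁ K₂ K : Type*) [Field F] [Field K₁] [Field K₂] [Field K]
  [Algebra F K₁] [Algebra F K₂] [Algebra F K] [Algebra K₁ K] [Algebra K₂ K]

/-- The pairs of units of `K₁` and `K₂` with equal norm in `F`. -/
noncomputable def equalNormSubgroup : Subgroup (K₁ˣ × K₂ˣ) :=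
  (((Units.map (Algebra.norm F (S := K₁))).comp (MonoidHom.fst K₁ˣ K₂ˣ))
    / ((Units.map (Algebra.norm F (S := K₂))).comp (MonoidHom.snd K₁ˣ K₂ˣ))).ker

variable {F K₁ K₂ K}

theorem mem_equalNormSubgroup {v : K₁ˣ × K₂ˣ} :
    v ∈ equalNormSubgroup F K₁ K₂
      ↔ Algebra.norm F (v.1 : K₁) = Algebra.norm F (v.2 : K₂) := by
  rw [equalNormSubgroup, MonoidHom.mem_ker, MonoidHom.div_apply, div_eq_one, Units.ext_iff]
  rfl

theorem card_equalNormSubgroup [Finite K₁] [Finite K₂] :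
    Nat.card (equalNormSubgroup F K₁ K₂) * (Nat.card F - 1)
      = (Nat.card K₁ - 1) * (Nat.card K₂ - 1) := by
  have hF : Finite F := Finite.of_injective _ (algebraMap F K₁).injective
  have h := Subgroup.card_mul_index (equalNormSubgroup F K₁ K₂)
  rw [equalNormSubgroup, Subgroup.index_ker, MonoidHom.range_eq_top.mpr, Subgroup.card_top,
    Nat.card_prod, Nat.card_units, Nat.card_units, Nat.card_units] at h
  · exact h
  · intro a
    obtain ⟨y, hy⟩ := FiniteField.unitsMap_norm_surjective F K₁ a
    refine ⟨(y, 1), ?_⟩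
    rw [MonoidHom.div_apply]
    simp [← hy]

variable [IsScalarTower F K₁ K] [IsScalarTower F K₂ K]

variable (F K₁ K₂ K) in
/-- The map `x ↦ (N_{K/K₁}(x), N_{K/K₂}(x))` into the pairs with equal norm in `F`. -/
noncomputable def normPair [Finite K] : Kˣ →* equalNormSubgroup F K₁ K₂ :=
  MonoidHom.codRestrict
    ((Units.map (Algebra.norm K₁ (S := K))).prod (Units.map (Algebra.norm K₂ (S := K)))) _
    fun x => by
      have h₁ : Algebra.norm F (Algebra.norm K₁ (x : K)) = Algebra.norm F (x : K) :=
        Algebra.norm_norm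
      have h₂ : Algebra.norm F (Algebra.norm K₂ (x : K)) = Algebra.norm F (x : K) :=
        Algebra.norm_norm
      rw [mem_equalNormSubgroup]
      exact h₁.trans h₂.symm

/-- A counting argument. The norm to Kᵢ is the power Aᵢ = (|K| - 1)/(|Kᵢ| - 1), so the kernel lies
in the solutions of x^gcd(A₁, A₂) = 1, of which the cyclic group Kˣ has at most gcd(A₁, A₂). Coprime
degrees give gcd(q^m₁ - 1, q^m₂ - 1) = q - 1, which makes this bound exactly |Kˣ| divided by the
order of the target. -/
theorem normPair_surjective [Finite K]
    (h : Nat.Coprime (Module.finrank F K₁) (Module.finrank F K₂)) :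
    Function.Surjective (normPair F K₁ K₂ K) := by
  classical
  have hK₁ : Finite K₁ := Finite.of_injective _ (algebraMap K₁ K).injective
  have hK₂ : Finite K₂ := Finite.of_injective _ (algebraMap K₂ K).injective
  have hF : Finite F := Finite.of_injective _ (algebraMap F K).injective
  have := Fintype.ofFinite F
  have := Fintype.ofFinite K
  have := Fintype.ofFinite K₁
  have := Fintype.ofFinite K₂
  have hd₁ := card_sub_one_div_mul_cancel K₁ K
  have hd₂ := card_sub_one_div_mul_cancel K₂ K
  set A₁ := (Nat.card K - 1) / (Nat.card K₁ - 1) with hA₁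
  set A₂ := (Nat.card K - 1) / (Nat.card K₂ - 1) with hA₂
  have hp := Nat.sub_pos_of_lt (Finite.one_lt_card (α := K))
  have hpF := Nat.sub_pos_of_lt (Finite.one_lt_card (α := F))
  have hA₁pos : 0 < A₁ := Nat.pos_of_mul_pos_right (hd₁ ▸ hp)
  have hker : Nat.card (normPair F K₁ K₂ K).ker ≤ Nat.gcd A₁ A₂ := by
    refine le_trans ?_ (IsCyclic.card_pow_eq_one_le (α := Kˣ) (Nat.gcd_pos_of_pos_left A₂ hA₁pos))
    rw [← Fintype.card_subtype, Fintype.card_eq_nat_card]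
    refine Nat.card_le_card_of_injective (fun x => ⟨x.1, ?_⟩)
      fun x y h => Subtype.ext (by simpa using h)
    have hx := congrArg Subtype.val (MonoidHom.mem_ker.mp x.2)
    have hx₁ : Algebra.norm K₁ ((x : Kˣ) : K) = 1 := congrArg (fun v => (v.1 : K₁)) hx
    have hx₂ : Algebra.norm K₂ ((x : Kˣ) : K) = 1 := congrArg (fun v => (v.2 : K₂)) hx
    have e₁ := FiniteField.algebraMap_norm_eq_pow (K := K₁) (x := ((x : Kˣ) : K))
    have e₂ := FiniteField.algebraMap_norm_eq_pow (K := K₂) (x := ((x : Kˣ) : K))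
    rw [hx₁, map_one] at e₁
    rw [hx₂, map_one] at e₂
    exact pow_gcd_eq_one.mpr ⟨Units.ext (by rw [Units.val_pow_eq_pow_val]; exact e₁.symm),
      Units.ext (by rw [Units.val_pow_eq_pow_val]; exact e₂.symm)⟩
  refine MonoidHom.surjective_of_card_ker_le_div _ (hker.trans ?_)
  rw [Nat.le_div_iff_mul_le Nat.card_pos, Nat.card_units]
  -- Multiplying by q - 1 replaces the order of the target by the product of the orders of K₁ˣ and
  -- K₂ˣ and avoids division.
  refine le_of_eq (Nat.eq_of_mul_eq_mul_right hpF ?_)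
  rw [mul_assoc, card_equalNormSubgroup, ← Nat.gcd_mul_right,
    show A₁ * ((Nat.card K₁ - 1) * (Nat.card K₂ - 1)) = (Nat.card K - 1) * (Nat.card K₂ - 1) by
      rw [← mul_assoc, hd₁],
    show A₂ * ((Nat.card K₁ - 1) * (Nat.card K₂ - 1)) = (Nat.card K - 1) * (Nat.card K₁ - 1) by
      rw [mul_comm (_ - 1), ← mul_assoc, hd₂],
    Nat.gcd_mul_left, Nat.gcd_comm, Module.natCard_eq_pow_finrank (K := F) (V := K₁),
    Module.natCard_eq_pow_finrank (K := F) (V := K₂), Nat.pow_sub_one_gcd_pow_sub_one,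
    Nat.coprime_iff_gcd_eq_one.mp h, pow_one]

/-- M is the order of the kernel of the joint norm map, hence the size of every fibre. -/
theorem exists_sum_normPair [Fintype F] [DecidableEq F] [Fintype K₁] [Fintype K₂] [Fintype K]
    [Fintype K₁ˣ] [Fintype K₂ˣ] [Fintype Kˣ]
    (h : Nat.Coprime (Module.finrank F K₁) (Module.finrank F K₂)) :
    ∃ M : ℕ, M * ((Fintype.card K₁ - 1) * (Fintype.card K₂ - 1))
        = (Fintype.card K - 1) * (Fintype.card F - 1) ∧
      ∀ g : K₁ → K₂ → ℤ, ∑ x : Kˣ, g (Algebra.norm K₁ (x : K)) (Algebra.norm K₂ (x : K))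
        = M * ∑ y : K₁ˣ, ∑ z : K₂ˣ,
          if Algebra.norm F (y : K₁) = Algebra.norm F (z : K₂) then g y z else 0 := by
  classical
  set φ := normPair F K₁ K₂ K
  have hφ := normPair_surjective (F := F) (K₁ := K₁) (K₂ := K₂) (K := K) h
  set M := (Finset.univ.filter fun x : Kˣ => φ x = 1).card
  have hM : ∀ v, (Finset.univ.filter fun x : Kˣ => φ x = v).card = M := fun v =>
    MonoidHom.card_fiber_eq_of_mem_range φ (hφ v) (hφ 1)
  refine ⟨M, ?_, fun g => ?_⟩
  · have h1 := card_equalNormSubgroup (F := F) (K₁ := K₁) (K₂ := K₂)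
    simp only [← Fintype.card_eq_nat_card] at h1
    rw [← h1, ← mul_assoc]
    congr 1
    rw [show Fintype.card K - 1 = Fintype.card Kˣ by
        simp only [Fintype.card_eq_nat_card, Nat.card_units], ← Finset.card_univ (α := Kˣ),
      Finset.card_eq_sum_card_fiberwise (f := φ) (s := Finset.univ) (t := Finset.univ) (by simp),
      Finset.sum_congr rfl fun v _ => hM v]
    simp [mul_comm]
  · have h1 : ∑ x : Kˣ, g (Algebra.norm K₁ (x : K)) (Algebra.norm K₂ (x : K))
        = ∑ x : Kˣ, g (φ x).1.1 (φ x).1.2 := rfl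
    rw [h1, ← Finset.sum_fiberwise (s := Finset.univ) (g := φ),
      ← Finset.sum_product' (f := fun (y : K₁ˣ) (z : K₂ˣ) =>
        if Algebra.norm F (y : K₁) = Algebra.norm F (z : K₂) then g y z else 0), Finset.mul_sum,
      Finset.univ_product_univ]
    have h2 : ∀ v : equalNormSubgroup F K₁ K₂,
        ∑ x : Kˣ with φ x = v, g (φ x).1.1 (φ x).1.2 = M * g v.1.1 v.1.2 := by
      intro v
      rw [Finset.sum_congr rfl (g := fun _ => g v.1.1 v.1.2)
        fun x hx => by rw [(Finset.mem_filter.mp hx).2], Finset.sum_const, hM, nsmul_eq_mul]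
    rw [Finset.sum_congr rfl fun v _ => h2 v]
    simp_rw [← mem_equalNormSubgroup, mul_ite, mul_zero]
    rw [← Finset.sum_filter]
    refine Finset.sum_bij (fun v _ => v.1) (fun v _ => ?_) (fun _ _ _ _ h => Subtype.ext h)
      (fun v hv => ⟨⟨v, ?_⟩, Finset.mem_univ _, rfl⟩) (fun _ _ => rfl)
    · simp
    · simpa using hv

end NormPair

/-! ### Counting units with prescribed traces -/

section Counting

variable {F K₁ K₂ K : Type*} [Field F] [Fintype F] [DecidableEq F]
  [Field K₁] [Fintype K₁] [Field K₂] [Fintype K₂] [Field K] [Fintype K]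
  [Algebra F K₁] [Algebra F K₂] [Algebra F K] [Algebra K₁ K] [Algebra K₂ K]

/-- The number of nonzero `z` with norm `a` and trace zero. -/
noncomputable def normTraceCount (F K₂ : Type*) [Field F] [DecidableEq F] [Field K₂]
    [Algebra F K₂] [Fintype K₂ˣ] (a : F) : ℤ :=
  ∑ z : K₂ˣ, if Algebra.norm F (z : K₂) = a ∧ Algebra.trace F K₂ z = 0 then 1 else 0

theorem normTraceCount_pow_mul [Fintype K₂ˣ] (t a : F) (ht : t ≠ 0) :
    normTraceCount F K₂ (t ^ Module.finrank F K₂ * a) = normTraceCount F K₂ a := by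
  unfold normTraceCount
  set u : K₂ˣ := Units.map (algebraMap F K₂).toMonoidHom (Units.mk0 t ht) with hu
  have huv : (u : K₂) = algebraMap F K₂ t := rfl
  rw [← Equiv.sum_comp (Equiv.mulLeft u)]
  refine Finset.sum_congr rfl fun z _ => ?_
  have h1 : Algebra.norm F ((u * z : K₂ˣ) : K₂)
      = t ^ Module.finrank F K₂ * Algebra.norm F (z : K₂) := by
    rw [Units.val_mul, huv, map_mul, Algebra.norm_algebraMap]
  have h2 : Algebra.trace F K₂ ((u * z : K₂ˣ) : K₂) = t * Algebra.trace F K₂ (z : K₂) := by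
    rw [Units.val_mul, huv, trace_algebraMap_mul]
  simp only [Equiv.coe_mulLeft, h1, h2]
  simp [ht]

theorem normTraceCount_eq_of_quadraticChar_eq [Fintype K₂ˣ]
    (hl : Nat.gcd (Module.finrank F K₂) (Fintype.card F - 1) = 2)
    {a a' : F} (ha : a ≠ 0) (ha' : a' ≠ 0) (h : quadraticChar F a = quadraticChar F a') :
    normTraceCount F K₂ a = normTraceCount F K₂ a' := by
  have hsq : IsSquare (a / a') := by
    rw [← quadraticChar_one_iff_isSquare (div_ne_zero ha ha')]
    have : quadraticChar F (a / a') * quadraticChar F a' = quadraticChar F a' := by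
      rw [← map_mul, div_mul_cancel₀ _ ha', h]
    exact mul_right_cancel₀ (by rwa [Ne, quadraticChar_eq_zero_iff]) (this.trans (one_mul _).symm)
  obtain ⟨s, hs⟩ := hsq
  have hs0 : s ≠ 0 := by
    rintro rfl
    exact div_ne_zero ha ha' (by simpa using hs)
  rw [← Fintype.card_units] at hl
  obtain ⟨t, ht⟩ := exists_pow_eq_sq_of_gcd_eq_two hl (Units.mk0 s hs0)
  have ht' : (t : F) ^ Module.finrank F K₂ = s ^ 2 := by
    simpa using congrArg (Units.val) ht
  rw [← normTraceCount_pow_mul (t : F) a' t.ne_zero, ht', sq, ← hs, div_mul_cancel₀ _ ha']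

/-- The count is a function on Fˣ modulo squares, so its sums against 1 and χ determine it. These
sums are the number of nonzero trace-zero elements and T_{K₂}(0). -/
theorem mul_normTraceCount [Fintype K₂ˣ]
    (hl : Nat.gcd (Module.finrank F K₂) (Fintype.card F - 1) = 2) {a : F} (ha : a ≠ 0) :
    ((Fintype.card F : ℤ) - 1) * normTraceCount F K₂ a
      = ((Fintype.card F : ℤ) ^ (Module.finrank F K₂ - 1) - 1)
        + quadraticChar F a * traceCharSum K₂ (0 : F) := by
  have hF : ringChar F ≠ 2 := by
    intro h2
    have hev := FiniteField.even_card_iff_char_two.mp h2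
    have hd : 2 ∣ Fintype.card F - 1 := hl ▸ Nat.gcd_dvd_right _ _
    have := Fintype.card_pos (α := F)
    omega
  have hA : ∑ a' : Fˣ, normTraceCount F K₂ (a' : F)
      = (Fintype.card F : ℤ) ^ (Module.finrank F K₂ - 1) - 1 := by
    unfold normTraceCount
    rw [Finset.sum_comm]
    have h1 : ∀ z : K₂ˣ, (∑ a' : Fˣ,
        if Algebra.norm F (z : K₂) = a' ∧ Algebra.trace F K₂ z = 0 then (1 : ℤ) else 0)
        = if Algebra.trace F K₂ (z : K₂) = 0 then 1 else 0 := by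
      intro z
      rw [Finset.sum_eq_single (Units.map (Algebra.norm F) z)]
      · simp
      · intro b _ hb
        rw [if_neg]
        rintro ⟨h, -⟩
        exact hb (Units.ext h.symm)
      · simp
    rw [Finset.sum_congr rfl fun z _ => h1 z,
      Fintype.sum_units_eq_sub fun z : K₂ => if Algebra.trace F K₂ z = 0 then (1 : ℤ) else 0,
      Finset.sum_boole, card_trace_eq']
    simp
  have hB : ∑ a' : Fˣ, quadraticChar F (a' : F) * normTraceCount F K₂ (a' : F)
      = traceCharSum K₂ (0 : F) := by
    unfold normTraceCount traceCharSum
    simp_rw [Finset.mul_sum]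
    rw [Finset.sum_comm]
    have h1 : ∀ z : K₂ˣ, (∑ a' : Fˣ, quadraticChar F (a' : F) *
        if Algebra.norm F (z : K₂) = a' ∧ Algebra.trace F K₂ z = 0 then (1 : ℤ) else 0)
        = if Algebra.trace F K₂ (z : K₂) = 0 then quadraticChar F (Algebra.norm F (z : K₂))
          else 0 := by
      intro z
      rw [Finset.sum_eq_single (Units.map (Algebra.norm F) z)]
      · simp
      · intro b _ hb
        rw [if_neg, mul_zero]
        rintro ⟨h, -⟩
        exact hb (Units.ext h.symm)
      · simp
    rw [Finset.sum_congr rfl fun z _ => h1 z, Fintype.sum_units_eq_sub fun z : K₂ =>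
      if Algebra.trace F K₂ z = 0 then quadraticChar F (Algebra.norm F z) else 0]
    simp
  have hχ : ∑ a' : Fˣ, quadraticChar F (a' : F) = 0 := by
    rw [Fintype.sum_units_eq_sub fun a' : F => quadraticChar F a', quadraticChar_sum_zero hF]
    simp
  -- The weight 1 + χ(a)χ(a') vanishes unless a and a' lie in the same square class, where the two
  -- counts agree.
  have h1 : ∑ a' : Fˣ, (1 + quadraticChar F a * quadraticChar F (a' : F))
        * normTraceCount F K₂ (a' : F)
      = ∑ a' : Fˣ, (1 + quadraticChar F a * quadraticChar F (a' : F))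
        * normTraceCount F K₂ a := by
    refine Finset.sum_congr rfl fun a' _ => ?_
    obtain h | h := quadraticChar_dichotomy ha <;>
      obtain h' | h' := quadraticChar_dichotomy a'.ne_zero
    · rw [normTraceCount_eq_of_quadraticChar_eq hl ha a'.ne_zero (h.trans h'.symm)]
    · simp [h, h']
    · simp [h, h']
    · rw [normTraceCount_eq_of_quadraticChar_eq hl ha a'.ne_zero (h.trans h'.symm)]
  simp only [add_mul, one_mul, Finset.sum_add_distrib, mul_assoc, ← Finset.mul_sum] at h1
  rw [← Finset.sum_mul, hA, hB, hχ] at h1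
  rw [h1, Finset.sum_const, Finset.card_univ, Fintype.card_units, nsmul_eq_mul,
    Nat.cast_sub Fintype.card_pos]
  simp

/-- The number of nonzero `x` with `Tr(N_{K/K₂}(x)) = 0` and `Tr(b N_{K/K₁}(x)) = c`. -/
noncomputable def unitCount (F K₂ K : Type*) {K₁ : Type*} [Field F] [DecidableEq F]
    [Field K₁] [Field K₂] [Field K] [Fintype Kˣ] [Algebra F K₁] [Algebra F K₂]
    [Algebra K₁ K] [Algebra K₂ K] (b : K₁) (c : F) : ℤ :=
  ∑ x : Kˣ, if Algebra.trace F K₂ (Algebra.norm K₂ (x : K)) = 0 ∧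
    Algebra.trace F K₁ (b * Algebra.norm K₁ (x : K)) = c then 1 else 0

/-- The sums over y are extended to all of K₁. The term y = 0 must be removed from the first, where
it occurs only for c = 0; in the second it is zero because χ(0) = 0. -/
theorem exists_mul_unitCount [Fintype Kˣ] [IsScalarTower F K₁ K] [IsScalarTower F K₂ K]
    (h : Nat.Coprime (Module.finrank F K₁) (Module.finrank F K₂))
    (hl : Nat.gcd (Module.finrank F K₂) (Fintype.card F - 1) = 2) :
    ∃ M : ℕ, M * ((Fintype.card K₁ - 1) * (Fintype.card K₂ - 1))
        = (Fintype.card K - 1) * (Fintype.card F - 1) ∧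
      ∀ (b : K₁) (c : F), ((Fintype.card F : ℤ) - 1) * unitCount F K₂ K b c
        = M * (((Fintype.card F : ℤ) ^ (Module.finrank F K₂ - 1) - 1)
              * ((∑ y : K₁, if Algebra.trace F K₁ (b * y) = c then 1 else 0)
                  - if c = 0 then 1 else 0)
            + traceCharSum K₂ (0 : F) * ∑ y : K₁, if Algebra.trace F K₁ (b * y) = c
                then quadraticChar F (Algebra.norm F y) else 0) := by
  classical
  obtain ⟨M, hM, hg⟩ := exists_sum_normPair (F := F) (K₁ := K₁) (K₂ := K₂) (K := K) h
  refine ⟨M, hM, fun b c => ?_⟩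
  have h1 : unitCount F K₂ K b c = M * ∑ y : K₁ˣ,
      if Algebra.trace F K₁ (b * (y : K₁)) = c then normTraceCount F K₂ (Algebra.norm F (y : K₁))
      else 0 := by
    unfold unitCount
    refine (hg fun y z => if Algebra.trace F K₂ z = 0 ∧ Algebra.trace F K₁ (b * y) = c
      then 1 else 0).trans (congrArg _ ?_)
    refine Finset.sum_congr rfl fun y _ => ?_
    unfold normTraceCount
    split_ifs with hc
    · refine Finset.sum_congr rfl fun z _ => ?_
      by_cases hz : Algebra.norm F (y : K₁) = Algebra.norm F (z : K₂)
      · simp [hz, hc]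
      · rw [if_neg hz, if_neg fun h' => hz h'.1.symm]
    · simp [hc]
  rw [h1, mul_left_comm]
  congr 1
  rw [Finset.mul_sum]
  have h2 : ∀ y : K₁ˣ, ((Fintype.card F : ℤ) - 1) *
      (if Algebra.trace F K₁ (b * (y : K₁)) = c then normTraceCount F K₂ (Algebra.norm F (y : K₁))
        else 0)
      = ((Fintype.card F : ℤ) ^ (Module.finrank F K₂ - 1) - 1)
          * (if Algebra.trace F K₁ (b * (y : K₁)) = c then 1 else 0)
        + traceCharSum K₂ (0 : F) * (if Algebra.trace F K₁ (b * (y : K₁)) = c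
            then quadraticChar F (Algebra.norm F (y : K₁)) else 0) := by
    intro y
    split_ifs
    · rw [mul_normTraceCount hl (by simp)]
      ring
    · simp
  rw [Finset.sum_congr rfl fun y _ => h2 y, Finset.sum_add_distrib, ← Finset.mul_sum,
    ← Finset.mul_sum, Fintype.sum_units_eq_sub fun y : K₁ =>
      if Algebra.trace F K₁ (b * y) = c then (1 : ℤ) else 0,
    Fintype.sum_units_eq_sub fun y : K₁ =>
      if Algebra.trace F K₁ (b * y) = c then quadraticChar F (Algebra.norm F y) else 0]
  simp [eq_comm]

theorem sum_trace_mul_eq {b : K₁} (hb : b ≠ 0) (c : F) :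
    (∑ y : K₁, if Algebra.trace F K₁ (b * y) = c then (1 : ℤ) else 0)
      = (Fintype.card F : ℤ) ^ (Module.finrank F K₁ - 1) := by
  rw [(mulLeft_bijective₀ b hb).sum_comp fun y =>
    if Algebra.trace F K₁ y = c then (1 : ℤ) else 0, Finset.sum_boole, card_trace_eq']
  simp

/-- Substituting by for y produces χ(N(b)), which is its own inverse. -/
theorem sum_trace_mul_quadraticChar {b : K₁} (hb : b ≠ 0) (c : F) :
    (∑ y : K₁, if Algebra.trace F K₁ (b * y) = c
        then quadraticChar F (Algebra.norm F y) else 0)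
      = quadraticChar F (Algebra.norm F b) * traceCharSum K₁ c := by
  unfold traceCharSum
  rw [← (mulLeft_bijective₀ b hb).sum_comp fun y => if Algebra.trace F K₁ y = c
    then quadraticChar F (Algebra.norm F y) else 0, Finset.mul_sum]
  refine Finset.sum_congr rfl fun y _ => ?_
  have : quadraticChar F (Algebra.norm F b) ^ 2 = 1 :=
    quadraticChar_sq_one (by simpa using hb)
  split_ifs
  · rw [map_mul, map_mul, ← mul_assoc, ← sq, this, one_mul]
  · simp

end Counting

/-- With these parametrizations the exponents m₁ - 1, m₂ - 1 and (m₁ + m₂ - 3)/2 become 2i, 2j + 1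
and i + j, free of truncation. -/
theorem three_le_and_parity {q m₁ m₂ : ℕ} (hq : 1 < q) (hm₂ : 0 < m₂)
    (he : Nat.gcd m₁ m₂ = 1) (hl : Nat.gcd m₂ (q - 1) = 2) :
    3 ≤ q ∧ (∃ i, m₁ = 2 * i + 1) ∧ ∃ j, m₂ = 2 * j + 2 := by
  have h2q : 2 ∣ q - 1 := hl ▸ Nat.gcd_dvd_right _ _
  have h2m : 2 ∣ m₂ := hl ▸ Nat.gcd_dvd_left _ _
  refine ⟨by omega, ?_, ⟨m₂ / 2 - 1, by omega⟩⟩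
  have : Odd m₁ := by
    rw [← Nat.not_even_iff_odd]
    intro h
    have := Nat.dvd_gcd h.two_dvd h2m
    omega
  exact this

/-! ### Hamming weights of the augmented code -/

section Weights

set_option linter.unusedSectionVars false

variable {F K₁ K₂ K : Type*} [Field F] [Fintype F] [DecidableEq F]
  [Field K₁] [Fintype K₁] [Field K₂] [Fintype K₂] [Field K] [Fintype K]
  [Algebra F K₁] [Algebra F K₂] [Algebra F K] [Algebra K₁ K] [Algebra K₂ K]

/-- The encoding map `(b, c) ↦ (Tr(b N_{K/K₁}(x)) + c)_{x ∈ D}` of the augmented code. -/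
noncomputable def augmentedEncoder (F K₁ : Type*) {K : Type*} [Field F] [Field K₁] [Field K]
    [Algebra F K₁] [Algebra K₁ K] (D : Finset K) : (K₁ × F) →ₗ[F] (D → F) where
  toFun p x := Algebra.trace F K₁ (p.1 * Algebra.norm K₁ (x : K)) + p.2
  map_add' p p' := by
    ext x
    simp only [Prod.fst_add, Prod.snd_add, Pi.add_apply, add_mul, map_add]
    ring
  map_smul' r p := by
    ext x
    simp only [Prod.smul_fst, Prod.smul_snd, Pi.smul_apply, smul_eq_mul, smul_mul_assoc, map_smul,
      RingHom.id_apply]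
    ring

theorem range_augmentedEncoder (F K₁ : Type*) {K : Type*} [Field F] [Field K₁] [Field K]
    [Algebra F K₁] [Algebra K₁ K] (D : Finset K) :
    LinearMap.range (augmentedEncoder F K₁ D) = augmentedCode F K₁ D := by
  ext u
  constructor
  · rintro ⟨⟨b, c⟩, rfl⟩
    exact ⟨b, c, rfl⟩
  · rintro ⟨b, c, rfl⟩
    exact ⟨(b, c), rfl⟩

/-- The extra term is the point x = 0, which always lies in D and has trace value 0. -/
theorem card_definingSet_trace_eq [Fintype Kˣ] (b : K₁) (c : F) :
    (((definingSet F K₂ K).filter fun x =>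
        Algebra.trace F K₁ (b * Algebra.norm K₁ x) = c).card : ℤ)
      = (if c = 0 then 1 else 0) + unitCount F K₂ K b c := by
  have h1 : (((definingSet F K₂ K).filter fun x =>
        Algebra.trace F K₁ (b * Algebra.norm K₁ x) = c).card : ℤ)
      = ∑ x : K, if Algebra.trace F K₂ (Algebra.norm K₂ x) = 0 ∧
          Algebra.trace F K₁ (b * Algebra.norm K₁ x) = c then 1 else 0 := by
    rw [definingSet, Finset.filter_filter, Finset.sum_boole]
  rw [h1, unitCount, Fintype.sum_units_eq_sub fun x : K =>
    if Algebra.trace F K₂ (Algebra.norm K₂ x) = 0 ∧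
      Algebra.trace F K₁ (b * Algebra.norm K₁ x) = c then (1 : ℤ) else 0]
  simp [eq_comm]

theorem hammingNorm_augmentedEncoder [Fintype Kˣ] (b : K₁) (c : F) :
    (hammingNorm (augmentedEncoder F K₁ (definingSet F K₂ K) (b, c)) : ℤ)
      = (definingSet F K₂ K).card - ((if c = 0 then 1 else 0) + unitCount F K₂ K b (-c)) := by
  have h2 := card_definingSet_trace_eq (F := F) (K₂ := K₂) (K := K) b (-c)
  simp only [neg_eq_zero] at h2
  rw [← h2, eq_sub_iff_add_eq, ← Finset.card_filter_add_card_filter_not (s := definingSet F K₂ K)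
    (fun x => Algebra.trace F K₁ (b * Algebra.norm K₁ x) = -c), Nat.cast_add, add_comm]
  congr 2
  refine Finset.card_bij (fun x _ => x.1) ?_ (fun _ _ _ _ h => Subtype.ext h) ?_
  · intro x hx
    have hx' : Algebra.trace F K₁ (b * Algebra.norm K₁ (x : K)) + c ≠ 0 :=
      (Finset.mem_filter.mp hx).2
    rw [Finset.mem_filter, ← add_eq_zero_iff_eq_neg]
    exact ⟨x.2, hx'⟩
  · intro x hx
    rw [Finset.mem_filter, ← add_eq_zero_iff_eq_neg] at hx
    exact ⟨⟨x, hx.1⟩, Finset.mem_filter.mpr ⟨Finset.mem_univ _, hx.2⟩, rfl⟩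

theorem card_definingSet [Fintype Kˣ] :
    ((definingSet F K₂ K).card : ℤ) = 1 + unitCount F K₂ K (0 : K₁) (0 : F) := by
  have h := card_definingSet_trace_eq (F := F) (K₂ := K₂) (K := K) (0 : K₁) 0
  simpa using h

theorem exists_weights [IsScalarTower F K₁ K] [IsScalarTower F K₂ K] {q m₁ m₂ : ℕ}
    (hq : Fintype.card F = q) (hm₁ : Module.finrank F K₁ = m₁) (hm₂ : Module.finrank F K₂ = m₂)
    (he : Nat.gcd m₁ m₂ = 1) (hl : Nat.gcd m₂ (q - 1) = 2) :
    ∃ M S : ℕ, ∃ δ : ℤ, (δ = 1 ∨ δ = -1) ∧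
      (M : ℤ) * (((q : ℤ) ^ m₁ - 1) * ((q : ℤ) ^ m₂ - 1))
        = ((q : ℤ) ^ Module.finrank F K - 1) * ((q : ℤ) - 1) ∧
      ((q : ℤ) - 1) * S = (q : ℤ) ^ (m₂ - 1) - 1 ∧
      ((definingSet F K₂ K).card : ℤ) = M * (((q : ℤ) ^ m₁ - 1) * S) + 1 ∧
      (∀ c : F, c ≠ 0 → hammingNorm (augmentedEncoder F K₁ (definingSet F K₂ K) (0, c))
        = (definingSet F K₂ K).card) ∧
      (∀ b : K₁, b ≠ 0 →
        (hammingNorm (augmentedEncoder F K₁ (definingSet F K₂ K) (b, 0)) : ℤ)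
          = M * (((q : ℤ) ^ m₁ - (q : ℤ) ^ (m₁ - 1)) * S)) ∧
      (∀ (b : K₁) (c : F), b ≠ 0 → c ≠ 0 →
        (hammingNorm (augmentedEncoder F K₁ (definingSet F K₂ K) (b, c)) : ℤ)
          = M * (((q : ℤ) ^ m₁ - (q : ℤ) ^ (m₁ - 1) - 1) * S
            + δ * quadraticChar F (Algebra.norm F b) * quadraticChar F c
              * (q : ℤ) ^ ((m₁ + m₂ - 3) / 2)) + 1) := by
  classical
  have hq1 : 1 < q := hq ▸ Fintype.one_lt_card
  have hq0 : (q : ℤ) - 1 ≠ 0 := by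
    have : (1 : ℤ) < q := by exact_mod_cast hq1
    linarith
  obtain ⟨hq3, ⟨i, hi⟩, ⟨j, hj⟩⟩ :=
    three_le_and_parity hq1 (hm₂ ▸ Module.finrank_pos : 0 < m₂) he hl
  have hF : ringChar F ≠ 2 := by
    intro h2
    have hev : q % 2 = 0 := hq ▸ FiniteField.even_card_iff_char_two.mp h2
    have h2q : 2 ∣ q - 1 := hl ▸ Nat.gcd_dvd_right _ _
    omega
  have hexp : (m₁ + m₂ - 3) / 2 = i + j := by omega
  have hT₁ := traceCharSum_one_sq_of_odd (L := K₁) hF ⟨i, hm₁.trans hi⟩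
  rw [hq, hm₁] at hT₁
  have hT₂ := traceCharSum_zero_sq_of_even (L := K₂) hF (hm₂.trans hj) (even_two_mul j)
  rw [hq] at hT₂
  obtain ⟨M, hM, hU⟩ := exists_mul_unitCount (F := F) (K₁ := K₁) (K₂ := K₂) (K := K)
    (by rwa [hm₁, hm₂]) (by rwa [hm₂, hq])
  simp only [hq, hm₂] at hU
  have hM' : (M : ℤ) * (((q : ℤ) ^ m₁ - 1) * ((q : ℤ) ^ m₂ - 1))
      = ((q : ℤ) ^ Module.finrank F K - 1) * ((q : ℤ) - 1) := by
    have h1 : ∀ k, 1 ≤ q ^ k := fun k => Nat.one_le_pow _ _ (by omega)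
    rw [Module.card_eq_pow_finrank (K := F) (V := K₁),
      Module.card_eq_pow_finrank (K := F) (V := K₂),
      Module.card_eq_pow_finrank (K := F) (V := K), hq, hm₁, hm₂] at hM
    have := congrArg (Nat.cast (R := ℤ)) hM
    push_cast [Nat.cast_sub (h1 _), Nat.cast_sub hq1.le] at this
    exact this
  set S := ∑ k ∈ Finset.range (m₂ - 1), q ^ k with hS
  have hS' : ((q : ℤ) - 1) * S = (q : ℤ) ^ (m₂ - 1) - 1 := by
    rw [hS]
    push_cast
    exact mul_geom_sum _ _
  -- Only the squares of the two character sums are known, so their product is determined up to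
  -- sign.
  have hprod : ∃ δ : ℤ, (δ = 1 ∨ δ = -1) ∧
      traceCharSum K₁ (1 : F) * traceCharSum K₂ (0 : F)
        = δ * (((q : ℤ) - 1) * (q : ℤ) ^ (i + j)) := by
    have hsq : (traceCharSum K₁ (1 : F) * traceCharSum K₂ (0 : F)) ^ 2
        = (((q : ℤ) - 1) * (q : ℤ) ^ (i + j)) ^ 2 := by
      rw [mul_pow, hT₁, hT₂, hi]
      simp only [Nat.add_sub_cancel]
      ring
    obtain h | h := sq_eq_sq_iff_eq_or_eq_neg.mp hsq
    · exact ⟨1, Or.inl rfl, by rw [h]; ring⟩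
    · exact ⟨-1, Or.inr rfl, by rw [h]; ring⟩
  obtain ⟨δ, hδ, hprod⟩ := hprod
  have hneg : quadraticChar F (-1) = 1 ∨ quadraticChar F (-1) = -1 :=
    quadraticChar_dichotomy (by simp)
  have hn : ((definingSet F K₂ K).card : ℤ) = M * (((q : ℤ) ^ m₁ - 1) * S) + 1 := by
    rw [card_definingSet (K₁ := K₁), add_comm]
    congr 1
    have h := hU 0 0
    simp only [zero_mul, map_zero, if_true, sum_quadraticChar_norm hF, mul_zero, add_zero,
      Finset.sum_const, Finset.card_univ, nsmul_eq_mul, mul_one] at h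
    rw [Module.card_eq_pow_finrank (K := F) (V := K₁), hq, hm₁, ← hS'] at h
    refine mul_left_cancel₀ hq0 (h.trans ?_)
    push_cast
    ring
  -- The minus sign comes from subtracting the zero coordinates from the length; χ(-1) appears
  -- because those coordinates have trace value -c.
  refine ⟨M, S, -δ * quadraticChar F (-1), ?_, hM', hS', hn, ?_, ?_, ?_⟩
  · obtain h | h := hneg <;> obtain rfl | rfl := hδ <;> simp [h]
  · intro c hc
    have h := hammingNorm_augmentedEncoder (F := F) (K₂ := K₂) (K := K) (0 : K₁) c
    have h0 : unitCount F K₂ K (0 : K₁) (-c) = 0 := by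
      simp [unitCount, eq_comm, hc]
    rw [h0, if_neg hc] at h
    rw [add_zero, sub_zero] at h
    exact_mod_cast h
  · intro b hb
    rw [hammingNorm_augmentedEncoder, hn]
    have h := hU b 0
    -- For c = 0 the character term drops out since T_{K₁}(0) = 0, so the weight does not depend on
    -- b.
    rw [sum_trace_mul_eq hb, sum_trace_mul_quadraticChar hb, hq, hm₁, ← hS',
      traceCharSum_zero_of_odd hF ⟨i, hm₁.trans hi⟩] at h
    have h' : unitCount F K₂ K b (0 : F) = M * (S * ((q : ℤ) ^ (m₁ - 1) - 1)) := by
      refine mul_left_cancel₀ hq0 (h.trans ?_)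
      simp only [if_true]
      ring
    rw [neg_zero, h', if_pos rfl]
    ring
  · intro b c hb hc
    rw [hammingNorm_augmentedEncoder, hn, hexp, if_neg hc]
    have h := hU b (-c)
    rw [sum_trace_mul_eq hb, sum_trace_mul_quadraticChar hb, hq, hm₁, ← hS',
      traceCharSum_eq_of_odd ⟨i, hm₁.trans hi⟩ _ (neg_ne_zero.mpr hc), if_neg (neg_ne_zero.mpr hc),
      neg_eq_neg_one_mul c, map_mul] at h
    have h' : unitCount F K₂ K b (-1 * c) = M * (S * (q : ℤ) ^ (m₁ - 1)
        + δ * quadraticChar F (Algebra.norm F b) * (quadraticChar F (-1) * quadraticChar F c)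
          * (q : ℤ) ^ (i + j)) := by
      refine mul_left_cancel₀ hq0 (h.trans ?_)
      linear_combination (M : ℤ) * quadraticChar F (Algebra.norm F b) *
        (quadraticChar F (-1) * quadraticChar F c) * hprod
    rw [neg_eq_neg_one_mul c, h']
    ring

end Weights

/-! ### Self-orthogonality from divisible weights -/

/-- Over a finite field of odd characteristic, a code that contains the constant words and whose
weights all vanish in the field is self-orthogonal. -/
theorem isSelfOrthogonalCode_of_weights {ι F : Type*} [Fintype ι] [Field F] [Fintype F]
    [DecidableEq F] (hF : ringChar F ≠ 2) (C : Submodule F (ι → F))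
    (hconst : ∀ c : F, (fun _ => c) ∈ C) (hC : ∀ u ∈ C, (hammingNorm u : F) = 0) :
    IsSelfOrthogonalCode C := by
  have hcard : (Fintype.card ι : F) = 0 := by
    have h := hC _ (hconst 1)
    simpa [hammingNorm] using h
  -- Subtracting the constant word a turns the fibre over a into the zero set of a codeword; both
  -- the length and that codeword's weight vanish in F.
  have hfib : ∀ u ∈ C, ∀ a : F, ((Finset.univ.filter fun i => u i = a).card : F) = 0 := by
    intro u hu a
    have h := hC _ (C.sub_mem hu (hconst a))
    have h2 := Finset.card_filter_add_card_filter_not (s := (Finset.univ : Finset ι))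
      (fun i => u i = a)
    have h3 : hammingNorm (u - fun _ => a) = (Finset.univ.filter fun i => ¬u i = a).card := by
      simp [hammingNorm, sub_eq_zero]
    rw [h3] at h
    have h4 := congrArg (Nat.cast (R := F)) h2
    rwa [Nat.cast_add, h, add_zero, Finset.card_univ, hcard] at h4
  have hsq : ∀ u ∈ C, ∑ i, u i * u i = 0 := by
    intro u hu
    rw [← Finset.sum_fiberwise (s := Finset.univ) (g := u)]
    refine Finset.sum_eq_zero fun a _ => ?_
    rw [Finset.sum_congr rfl (g := fun _ => a * a)
      fun i hi => by rw [(Finset.mem_filter.mp hi).2], Finset.sum_const, nsmul_eq_mul,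
      hfib u hu a, zero_mul]
  intro u hu v hv
  -- Polarization: the sums of squares for u, v and u + v vanish, leaving twice the inner product.
  have h := hsq _ (C.add_mem hu hv)
  have h2 : ∑ i, (u + v) i * (u + v) i
      = ∑ i, u i * u i + 2 * ∑ i, u i * v i + ∑ i, v i * v i := by
    rw [Finset.mul_sum, ← Finset.sum_add_distrib, ← Finset.sum_add_distrib]
    refine Finset.sum_congr rfl fun i _ => ?_
    simp only [Pi.add_apply]
    ring
  rw [h2, hsq u hu, hsq v hv, zero_add, add_zero] at h
  exact (mul_eq_zero.mp h).resolve_left (Ring.two_ne_zero hF)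

theorem Fintype.sum_eq_zero_term_add {A : Type*} [Fintype A] [Zero A] (f : A → ℚ) (t : ℚ)
    (h : ∀ a, a ≠ 0 → f a = t) : ∑ a, f a = f 0 + ((Fintype.card A : ℚ) - 1) * t := by
  classical
  rw [← Finset.add_sum_erase _ _ (Finset.mem_univ (0 : A)),
    Finset.sum_congr rfl fun a ha => h a (Finset.ne_of_mem_erase ha), Finset.sum_const,
    Finset.card_erase_of_mem (Finset.mem_univ _), Finset.card_univ, nsmul_eq_mul,
    Nat.cast_sub Fintype.card_pos, Nat.cast_one]

/-! ### From weights to frequencies -/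

section Distribution

variable {F V ι : Type*} [Field F] [DecidableEq F] [Fintype V] [Fintype ι]
  [AddCommGroup V] [Module F V]

theorem weightCount_range (f : V →ₗ[F] (ι → F)) (hf : Function.Injective f) (j : ℕ) :
    (weightCount (LinearMap.range f) j : ℚ) = ∑ v, if j = hammingNorm (f v) then 1 else 0 := by
  classical
  have h : {u : ι → F | u ∈ LinearMap.range f ∧ hammingNorm u = j}
      = f '' {v | j = hammingNorm (f v)} := by
    ext u
    constructor
    · rintro ⟨⟨v, rfl⟩, hv⟩
      exact ⟨v, hv.symm, rfl⟩
    · rintro ⟨v, hv, rfl⟩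
      exact ⟨⟨v, rfl⟩, Eq.symm hv⟩
  rw [weightCount, h, Set.ncard_image_of_injective _ hf, Finset.sum_boole,
    ← Set.ncard_coe_finset]
  simp

theorem weightCount_eq_of_weights [Fintype F] (hF : ringChar F ≠ 2) (f : (V × F) →ₗ[F] (ι → F))
    (hf : Function.Injective f) (η : V → ℤ) (hη : ∀ v, v ≠ 0 → η v = 1 ∨ η v = -1)
    {n w wp wm : ℕ} (h₁ : ∀ c, c ≠ 0 → hammingNorm (f (0, c)) = n)
    (h₂ : ∀ v, v ≠ 0 → hammingNorm (f (v, 0)) = w)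
    (h₃ : ∀ v c, v ≠ 0 → c ≠ 0 →
      hammingNorm (f (v, c)) = if η v * quadraticChar F c = 1 then wp else wm) (j : ℕ) :
    (weightCount (LinearMap.range f) j : ℚ) =
      (if j = 0 then 1 else 0)
      + (if j = n then (Fintype.card F : ℚ) - 1 else 0)
      + (if j = w then (Fintype.card V : ℚ) - 1 else 0)
      + (if j = wp then ((Fintype.card V : ℚ) - 1) * ((Fintype.card F : ℚ) - 1) / 2 else 0)
      + (if j = wm then ((Fintype.card V : ℚ) - 1) * ((Fintype.card F : ℚ) - 1) / 2 else 0) := by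
  rw [weightCount_range f hf, Fintype.sum_prod_type]
  set P : ℚ := if j = wp then 1 else 0 with hP
  set N : ℚ := if j = wm then 1 else 0 with hN
  have hχ : ∑ c : F, (quadraticChar F c : ℚ) = 0 := by
    exact_mod_cast quadraticChar_sum_zero hF
  have hin : ∀ v : V, v ≠ 0 → (∑ c : F, if j = hammingNorm (f (v, c)) then (1 : ℚ) else 0)
      = (if j = w then 1 else 0) + ((Fintype.card F : ℚ) - 1) * ((P + N) / 2) := by
    intro v hv
    -- Subtracting the χ-component leaves the average (P + N)/2 at every c ≠ 0, and that component
    -- sums to zero over F. This gives each sign half of the nonzero c.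
    have h := Fintype.sum_eq_zero_term_add
      (fun c : F => (if j = hammingNorm (f (v, c)) then (1 : ℚ) else 0)
        - η v * ((P - N) / 2) * quadraticChar F c) ((P + N) / 2) (by
      intro c hc
      simp only [h₃ v c hv hc]
      obtain h | h := hη v hv <;> obtain h' | h' := quadraticChar_dichotomy hc <;>
        rw [h, h'] <;> norm_num <;> ring)
    rw [Finset.sum_sub_distrib, ← Finset.mul_sum, hχ, mul_zero, sub_zero] at h
    rw [h, h₂ v hv]
    simp
  rw [Fintype.sum_eq_zero_term_add _ _ hin, Fintype.sum_eq_zero_term_add (A := F)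
    (fun c => if j = hammingNorm (f (0, c)) then (1 : ℚ) else 0) (if j = n then 1 else 0)
    fun c hc => by simp only [h₁ c hc]]
  have h0 : f (0, 0) = 0 := map_zero f
  rw [h0, hammingNorm_zero, hP, hN]
  split_ifs <;> ring

end Distribution

/-! ### Arithmetic of the length and the weights -/

section Arithmetic

/-- S is the geometric sum 1 + q + ... + q^(2j), bounded below by its top term. -/
theorem le_geometric_quotient {q S : ℤ} {j : ℕ} (hq : 3 ≤ q)
    (hS : (q - 1) * S = q ^ (2 * j + 1) - 1) : q ^ (2 * j) ≤ S := by
  have h1 : 1 ≤ q ^ (2 * j) := one_le_pow₀ (by linarith)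
  have h2 : (q - 1) * q ^ (2 * j) ≤ (q - 1) * S := by
    rw [hS, pow_succ']
    linarith
  exact le_of_mul_le_mul_left h2 (by linarith)

theorem pow_le_mul_geometric_quotient {q S : ℤ} {i j : ℕ} (hq : 3 ≤ q)
    (hS : (q - 1) * S = q ^ (2 * j + 1) - 1) :
    q ^ (i + j) ≤ (q ^ (2 * i + 1) - q ^ (2 * i) - 1) * S := by
  have hS1 := le_geometric_quotient hq hS
  have h1 : 1 ≤ q ^ (2 * i) := one_le_pow₀ (by linarith)
  have h2 : q ^ (2 * i) ≤ q ^ (2 * i + 1) - q ^ (2 * i) - 1 := by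
    rw [pow_succ]
    nlinarith
  calc q ^ (i + j) ≤ q ^ (2 * i + 2 * j) := pow_le_pow_right₀ (by linarith) (by omega)
    _ = q ^ (2 * i) * q ^ (2 * j) := pow_add _ _ _
    _ ≤ _ := mul_le_mul h2 hS1 (by positivity) (by linarith)

/-- The difference of the two sides, times M, is n - wp. -/
theorem pow_lt_mul_geometric_quotient {q S : ℤ} {i j : ℕ} (hq : 3 ≤ q) (hij : 0 < i + j)
    (hS : (q - 1) * S = q ^ (2 * j + 1) - 1) : q ^ (i + j) < q ^ (2 * i) * S := by
  have hS1 := le_geometric_quotient hq hS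
  calc q ^ (i + j) < q ^ (2 * i + 2 * j) := pow_lt_pow_right₀ (by linarith) (by omega)
    _ = q ^ (2 * i) * q ^ (2 * j) := pow_add _ _ _
    _ ≤ _ := mul_le_mul_of_nonneg_left hS1 (by positivity)

/-- Equality would give q^(k+1) - q^k + 1 = q^(2j). For j = 0 the left side is too large; for j, k >
0 reduction modulo q fails; for k = 0 it reads q = q^(2j), against the parity of the exponent. -/
theorem geometric_quotient_ne_pow_add_one {q S : ℤ} {k j : ℕ} (hq : 3 ≤ q)
    (hS : (q - 1) * S = q ^ (2 * j + 1) - 1) : S ≠ q ^ (k + 1) + 1 := by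
  rintro rfl
  have hq0 : q ≠ 0 := by linarith
  have h : q ^ (k + 1) - q ^ k + 1 = q ^ (2 * j) := by
    refine mul_left_cancel₀ hq0 ?_
    linear_combination hS
  have hk1 : 1 ≤ q ^ k := one_le_pow₀ (by linarith)
  have hnd : ¬ q ∣ 1 := fun hd => by
    have := Int.le_of_dvd one_pos hd
    linarith
  obtain _ | j := j
  · rw [pow_succ] at h
    simp only [mul_zero, pow_zero] at h
    nlinarith
  · obtain _ | k := k
    · have h' : q ^ 1 = q ^ (2 * (j + 1)) := by linear_combination h
      have := pow_right_injective₀ (by linarith : (0 : ℤ) < q) (by linarith) h'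
      omega
    · refine hnd ⟨q ^ (2 * j + 1) - q ^ (k + 1) + q ^ k, ?_⟩
      linear_combination h

theorem Set.ncard_insert_four {A : Type*} {a b c d : A} (hab : a ≠ b) (hac : a ≠ c) (had : a ≠ d)
    (hbc : b ≠ c) (hbd : b ≠ d) (hcd : c ≠ d) : ({a, b, c, d} : Set A).ncard = 4 := by
  classical
  rw [show ({a, b, c, d} : Set A) = (({a, b, c, d} : Finset A) : Set A) by simp,
    Set.ncard_coe_finset]
  simp [hab, hac, had, hbc, hbd, hcd]

/-- The integer form of the length `n` and the weights `w`, `wp`, `wm` of the augmented code, for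
degrees `m₁ = 2 * i + 1` and `m₂ = 2 * j + 2`. -/
structure WeightParameters (q m i j M S n w wp wm : ℕ) : Prop where
  three_le : 3 ≤ q
  pos : 0 < m
  mul_eq : (M : ℤ) * (((q : ℤ) ^ (2 * i + 1) - 1) * ((q : ℤ) ^ (2 * j + 2) - 1))
    = ((q : ℤ) ^ m - 1) * ((q : ℤ) - 1)
  geom_eq : ((q : ℤ) - 1) * S = (q : ℤ) ^ (2 * j + 1) - 1
  length_eq : (n : ℤ) = M * (((q : ℤ) ^ (2 * i + 1) - 1) * S) + 1
  w_eq : (w : ℤ) = M * (((q : ℤ) ^ (2 * i + 1) - (q : ℤ) ^ (2 * i)) * S)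
  wp_eq : (wp : ℤ)
    = M * (((q : ℤ) ^ (2 * i + 1) - (q : ℤ) ^ (2 * i) - 1) * S + (q : ℤ) ^ (i + j)) + 1
  wm_eq : (wm : ℤ)
    = M * (((q : ℤ) ^ (2 * i + 1) - (q : ℤ) ^ (2 * i) - 1) * S - (q : ℤ) ^ (i + j)) + 1

namespace WeightParameters

theorem one_le_multiplier {q M a b m : ℕ} (hq : 3 ≤ q) (hm : 0 < m)
    (hM : (M : ℤ) * (((q : ℤ) ^ a - 1) * ((q : ℤ) ^ b - 1))
      = ((q : ℤ) ^ m - 1) * ((q : ℤ) - 1)) : (1 : ℤ) ≤ M := by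
  have hq3 : (3 : ℤ) ≤ q := by exact_mod_cast hq
  have h1 : (M : ℤ) ≠ 0 := by
    intro h0
    rw [h0, zero_mul] at hM
    have : (1 : ℤ) < (q : ℤ) ^ m := one_lt_pow₀ (by linarith) hm.ne'
    exact absurd hM.symm (mul_ne_zero (by linarith) (by linarith))
  have h2 : (0 : ℤ) ≤ M := by positivity
  omega

variable {q m i j M S n w wp wm : ℕ}

theorem exists_of_mul_eq (hq : 3 ≤ q) (hm : 0 < m)
    (hM : (M : ℤ) * (((q : ℤ) ^ (2 * i + 1) - 1) * ((q : ℤ) ^ (2 * j + 2) - 1))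
      = ((q : ℤ) ^ m - 1) * ((q : ℤ) - 1))
    (hS : ((q : ℤ) - 1) * S = (q : ℤ) ^ (2 * j + 1) - 1)
    (hn : (n : ℤ) = M * (((q : ℤ) ^ (2 * i + 1) - 1) * S) + 1) :
    ∃ w wp wm, WeightParameters q m i j M S n w wp wm := by
  have hq3 : (3 : ℤ) ≤ q := by exact_mod_cast hq
  have hE := pow_le_mul_geometric_quotient (i := i) hq3 hS
  have hE0 : 0 ≤ (q : ℤ) ^ (i + j) := by positivity
  have hM0 : (0 : ℤ) ≤ M := by positivity
  have hS0 : (0 : ℤ) ≤ S := by positivity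
  have hR : (0 : ℤ) ≤ (q : ℤ) ^ (2 * i + 1) - (q : ℤ) ^ (2 * i) :=
    sub_nonneg.mpr (pow_le_pow_right₀ (by linarith) (by omega))
  exact ⟨_, _, _, hq, hm, hM, hS, hn, Int.toNat_of_nonneg (mul_nonneg hM0 (mul_nonneg hR hS0)),
    Int.toNat_of_nonneg (add_nonneg (mul_nonneg hM0 (by linarith)) zero_le_one),
    Int.toNat_of_nonneg (add_nonneg (mul_nonneg hM0 (by linarith)) zero_le_one)⟩

theorem pos_and_lt (h : WeightParameters q m i j M S n w wp wm) :
    0 < n ∧ 0 < w ∧ 0 < wm ∧ wm < wp := by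
  have hq3 : (3 : ℤ) ≤ q := by exact_mod_cast h.three_le
  have hM := one_le_multiplier h.three_le h.pos h.mul_eq
  have hS : (1 : ℤ) ≤ S :=
    le_trans (one_le_pow₀ (by linarith)) (le_geometric_quotient hq3 h.geom_eq)
  have hE := pow_le_mul_geometric_quotient (i := i) hq3 h.geom_eq
  have hE1 : (1 : ℤ) ≤ (q : ℤ) ^ (i + j) := one_le_pow₀ (by linarith)
  have hR : (0 : ℤ) < (q : ℤ) ^ (2 * i + 1) - (q : ℤ) ^ (2 * i) :=
    sub_pos.mpr (pow_lt_pow_right₀ (by linarith) (by omega))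
  have hR1 : (1 : ℤ) ≤ (q : ℤ) ^ (2 * i + 1) := one_le_pow₀ (by linarith)
  refine ⟨?_, ?_, ?_, ?_⟩
  · have h0 : (0 : ℤ) ≤ M * (((q : ℤ) ^ (2 * i + 1) - 1) * S) :=
      mul_nonneg (by linarith) (mul_nonneg (by linarith) (by linarith))
    have := h.length_eq
    have : (0 : ℤ) < n := by linarith
    exact_mod_cast this
  · have : (0 : ℤ) < w := by
      rw [h.w_eq]
      exact mul_pos (by linarith) (mul_pos hR (by linarith))
    exact_mod_cast this
  · have h0 := mul_nonneg (by linarith : (0 : ℤ) ≤ M) (sub_nonneg.mpr hE)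
    have := h.wm_eq
    have : (0 : ℤ) < wm := by linarith
    exact_mod_cast this
  · have h0 : (0 : ℤ) < M * (q : ℤ) ^ (i + j) := mul_pos (by linarith) (by linarith)
    have : (wm : ℤ) < wp := by
      rw [h.wm_eq, h.wp_eq]
      linarith
    exact_mod_cast this

theorem lt_and_ne (h : WeightParameters q m i j M S n w wp wm) (hij : 0 < i + j) :
    wp < n ∧ w < n ∧ wm < w ∧ w ≠ wp := by
  have hq3 : (3 : ℤ) ≤ q := by exact_mod_cast h.three_le
  have hM := one_le_multiplier h.three_le h.pos h.mul_eq
  have hS : (1 : ℤ) ≤ S :=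
    le_trans (one_le_pow₀ (by linarith)) (le_geometric_quotient hq3 h.geom_eq)
  have hE1 : (1 : ℤ) ≤ (q : ℤ) ^ (i + j) := one_le_pow₀ (by linarith)
  have hqi : (1 : ℤ) ≤ (q : ℤ) ^ (2 * i) := one_le_pow₀ (by linarith)
  refine ⟨?_, ?_, ?_, ?_⟩
  · have h0 := mul_lt_mul_of_pos_left (pow_lt_mul_geometric_quotient hq3 hij h.geom_eq)
      (by linarith : (0 : ℤ) < M)
    have : (wp : ℤ) < n := by
      rw [h.wp_eq, h.length_eq]
      linarith
    exact_mod_cast this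
  · have h0 : 0 ≤ (M : ℤ) * (((q : ℤ) ^ (2 * i) - 1) * S) :=
      mul_nonneg (by linarith) (mul_nonneg (by linarith) (by linarith))
    have : (w : ℤ) < n := by
      rw [h.w_eq, h.length_eq]
      linarith
    exact_mod_cast this
  · have h0 : 1 * 2 ≤ (M : ℤ) * (S + (q : ℤ) ^ (i + j)) :=
      mul_le_mul hM (by linarith) (by norm_num) (by linarith)
    have : (wm : ℤ) < w := by
      rw [h.w_eq, h.wm_eq]
      linarith
    exact_mod_cast this
  · intro hw
    -- The difference w - wp equals M(S - q^(i+j)) - 1, so a coincidence forces S = q^(i+j) + 1.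
    have h1 : (M : ℤ) * (S - (q : ℤ) ^ (i + j)) = 1 := by
      have : (w : ℤ) = wp := by exact_mod_cast hw
      rw [h.w_eq, h.wp_eq] at this
      linarith
    have h2 : (S : ℤ) - (q : ℤ) ^ (i + j) = 1 := by
      obtain ⟨-, h2⟩ | ⟨h2, -⟩ := Int.mul_eq_one_iff_eq_one_or_neg_one.mp h1
      · exact h2
      · linarith
    obtain ⟨k, hk⟩ := Nat.exists_eq_add_one.mpr hij
    refine geometric_quotient_ne_pow_add_one (k := k) hq3 h.geom_eq ?_
    rw [← hk]
    linarith

/-- Modulo q both M and S are 1, and i ≠ 0 kills q^(2i) and q^(i+j); what survives in n, wp and wm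
is -1 + 1. -/
theorem dvd (h : WeightParameters q m i j M S n w wp wm) (hi : i ≠ 0) :
    q ∣ n ∧ q ∣ w ∧ q ∣ wp ∧ q ∣ wm := by
  have hdvd : ∀ x : ℕ, ((x : ℤ) : ZMod q) = 0 → q ∣ x := fun x hx =>
    (ZMod.natCast_eq_zero_iff x q).mp (by exact_mod_cast hx)
  have hq0 : ((q : ℤ) : ZMod q) = 0 := by simp
  have hz : ∀ k, k ≠ 0 → (((q : ℤ) ^ k : ℤ) : ZMod q) = 0 := fun k hk => by
    rw [Int.cast_pow, hq0, zero_pow hk]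
  have hM : ((M : ℤ) : ZMod q) = 1 := by
    have h1 := congrArg (Int.cast (R := ZMod q)) h.mul_eq
    simp only [Int.cast_mul, Int.cast_sub, Int.cast_one, hq0, hz m h.pos.ne',
      hz (2 * i + 1) (by omega), hz (2 * j + 2) (by omega)] at h1
    linear_combination h1
  have hS : ((S : ℤ) : ZMod q) = 1 := by
    have h1 := congrArg (Int.cast (R := ZMod q)) h.geom_eq
    simp only [Int.cast_mul, Int.cast_sub, Int.cast_one, hq0, hz (2 * j + 1) (by omega)] at h1
    linear_combination -h1
  refine ⟨hdvd n ?_, hdvd w ?_, hdvd wp ?_, hdvd wm ?_⟩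
  · rw [h.length_eq]
    simp only [Int.cast_add, Int.cast_mul, Int.cast_sub, Int.cast_one, hM, hS,
      hz (2 * i + 1) (by omega)]
    ring
  · rw [h.w_eq]
    simp only [Int.cast_mul, Int.cast_sub, hz (2 * i + 1) (by omega), hz (2 * i) (by omega)]
    ring
  · rw [h.wp_eq]
    simp only [Int.cast_add, Int.cast_mul, Int.cast_sub, Int.cast_one, hM, hS,
      hz (2 * i + 1) (by omega), hz (2 * i) (by omega), hz (i + j) (by omega)]
    ring
  · rw [h.wm_eq]
    simp only [Int.cast_add, Int.cast_mul, Int.cast_sub, Int.cast_one, hM, hS,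
      hz (2 * i + 1) (by omega), hz (2 * i) (by omega), hz (i + j) (by omega)]
    ring

theorem rat_formulas (h : WeightParameters q m i j M S n w wp wm) :
    (n : ℚ) = ((q : ℚ) ^ m - 1) * ((q : ℚ) ^ (2 * j + 2) - q)
      / (q * ((q : ℚ) ^ (2 * j + 2) - 1)) + 1 ∧
    (w : ℚ) = (q : ℚ) ^ (2 * i) * ((q : ℚ) ^ m - 1) * ((q : ℚ) - 1) *
      ((q : ℚ) ^ (2 * j + 1) - 1)
      / (((q : ℚ) ^ (2 * i + 1) - 1) * ((q : ℚ) ^ (2 * j + 2) - 1)) ∧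
    (wp : ℚ) = ((q : ℚ) ^ m - 1) *
      (((q : ℚ) ^ (2 * j + 1) - 1) * ((q : ℚ) ^ (2 * i + 1) - (q : ℚ) ^ (2 * i) - 1)
        + ((q : ℚ) - 1) * (q : ℚ) ^ (i + j))
      / (((q : ℚ) ^ (2 * i + 1) - 1) * ((q : ℚ) ^ (2 * j + 2) - 1)) + 1 ∧
    (wm : ℚ) = ((q : ℚ) ^ m - 1) *
      (((q : ℚ) ^ (2 * j + 1) - 1) * ((q : ℚ) ^ (2 * i + 1) - (q : ℚ) ^ (2 * i) - 1)
        - ((q : ℚ) - 1) * (q : ℚ) ^ (i + j))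
      / (((q : ℚ) ^ (2 * i + 1) - 1) * ((q : ℚ) ^ (2 * j + 2) - 1)) + 1 := by
  have hq3 : (3 : ℚ) ≤ q := by exact_mod_cast h.three_le
  have h₁ : (q : ℚ) ^ (2 * i + 1) - 1 ≠ 0 :=
    (sub_pos.mpr (one_lt_pow₀ (by linarith) (by omega))).ne'
  have h₂ : (q : ℚ) ^ (2 * j + 2) - 1 ≠ 0 :=
    (sub_pos.mpr (one_lt_pow₀ (by linarith) (by omega))).ne'
  have hq0 : (q : ℚ) ≠ 0 := by linarith
  have hM : (M : ℚ) * (((q : ℚ) ^ (2 * i + 1) - 1) * ((q : ℚ) ^ (2 * j + 2) - 1))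
    = ((q : ℚ) ^ m - 1) * ((q : ℚ) - 1) := by exact_mod_cast h.mul_eq
  have hS : ((q : ℚ) - 1) * S = (q : ℚ) ^ (2 * j + 1) - 1 := by exact_mod_cast h.geom_eq
  have hn : (n : ℚ) = M * (((q : ℚ) ^ (2 * i + 1) - 1) * S) + 1 := by exact_mod_cast h.length_eq
  have hw : (w : ℚ) = M * (((q : ℚ) ^ (2 * i + 1) - (q : ℚ) ^ (2 * i)) * S) := by
    exact_mod_cast h.w_eq
  have hwp : (wp : ℚ)
    = M * (((q : ℚ) ^ (2 * i + 1) - (q : ℚ) ^ (2 * i) - 1) * S + (q : ℚ) ^ (i + j)) + 1 := by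
    exact_mod_cast h.wp_eq
  have hwm : (wm : ℚ)
    = M * (((q : ℚ) ^ (2 * i + 1) - (q : ℚ) ^ (2 * i) - 1) * S - (q : ℚ) ^ (i + j)) + 1 := by
    exact_mod_cast h.wm_eq
  have hj : (q : ℚ) ^ (2 * j + 2) = q * (q : ℚ) ^ (2 * j + 1) := pow_succ' _ _
  have hi : (q : ℚ) ^ (2 * i + 1) = q * (q : ℚ) ^ (2 * i) := pow_succ' _ _
  refine ⟨?_, ?_, ?_, ?_⟩
  · rw [hn, add_left_inj, eq_div_iff (mul_ne_zero hq0 h₂)]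
    linear_combination (q : ℚ) * S * hM + (q : ℚ) * ((q : ℚ) ^ m - 1) * hS
      - ((q : ℚ) ^ m - 1) * hj
  · rw [hw, eq_div_iff (mul_ne_zero h₁ h₂)]
    linear_combination ((q : ℚ) ^ (2 * i + 1) - (q : ℚ) ^ (2 * i)) * S * hM
      + ((q : ℚ) ^ m - 1) * ((q : ℚ) ^ (2 * i + 1) - (q : ℚ) ^ (2 * i)) * hS
      + ((q : ℚ) ^ m - 1) * ((q : ℚ) ^ (2 * j + 1) - 1) * hi
  · rw [hwp, add_left_inj, eq_div_iff (mul_ne_zero h₁ h₂)]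
    linear_combination (((q : ℚ) ^ (2 * i + 1) - (q : ℚ) ^ (2 * i) - 1) * S
        + (q : ℚ) ^ (i + j)) * hM
      + ((q : ℚ) ^ m - 1) * ((q : ℚ) ^ (2 * i + 1) - (q : ℚ) ^ (2 * i) - 1) * hS
  · rw [hwm, add_left_inj, eq_div_iff (mul_ne_zero h₁ h₂)]
    linear_combination (((q : ℚ) ^ (2 * i + 1) - (q : ℚ) ^ (2 * i) - 1) * S
        - (q : ℚ) ^ (i + j)) * hM
      + ((q : ℚ) ^ m - 1) * ((q : ℚ) ^ (2 * i + 1) - (q : ℚ) ^ (2 * i) - 1) * hS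

end WeightParameters

end Arithmetic

/-! ### The four-weight criterion and the final assembly -/

theorem isTWeightCode_four_of_weightCount {ι F : Type*} [Fintype ι] [Field F] [DecidableEq F]
    {C : Submodule F (ι → F)} {n w wp wm : ℕ} {a b c d : ℚ} (ha : 0 < a) (hb : 0 < b) (hc : 0 < c)
    (hd : 0 < d) (hn : n = Fintype.card ι) (hwm : 0 < wm) (hmw : wm < w) (hmp : wm < wp)
    (hwn : w < n) (hpn : wp < n) (hne : w ≠ wp)
    (hdist : ∀ k : ℕ, (weightCount C k : ℚ) = (if k = 0 then 1 else 0) + (if k = n then a else 0)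
      + (if k = w then b else 0) + (if k = wp then c else 0) + (if k = wm then d else 0)) :
    IsTWeightCode 4 C := by
  have hset : {k : ℕ | 1 ≤ k ∧ k ≤ Fintype.card ι ∧ weightCount C k ≠ 0} = {n, w, wp, wm} := by
    ext k
    simp only [Set.mem_ofPred_eq, Set.mem_insert_iff, Set.mem_singleton_iff]
    constructor
    · rintro ⟨h1, -, h3⟩
      by_contra! hk
      have h := hdist k
      rw [if_neg (by omega), if_neg hk.1, if_neg hk.2.1, if_neg hk.2.2.1, if_neg hk.2.2.2] at h
      norm_num at h
      exact h3 h
    · intro hk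
      refine ⟨by omega, by omega, fun h0 => ?_⟩
      have h := hdist k
      rw [h0, Nat.cast_zero] at h
      -- All terms are nonnegative, so one positive frequency cannot be cancelled.
      have hge : ∀ (p : Prop) [Decidable p] (t : ℚ), 0 < t → 0 ≤ if p then t else 0 := by
        intro p _ t ht
        split_ifs <;> linarith
      have g0 := hge (k = 0) 1 one_pos
      have g1 := hge (k = n) a ha
      have g2 := hge (k = w) b hb
      have g3 := hge (k = wp) c hc
      have g4 := hge (k = wm) d hd
      obtain hk | hk | hk | hk := hk
      · rw [if_pos hk] at h g1; linarith
      · rw [if_pos hk] at h g2; linarith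
      · rw [if_pos hk] at h g3; linarith
      · rw [if_pos hk] at h g4; linarith
  rw [IsTWeightCode, hset]
  exact Set.ncard_insert_four hwn.ne' hpn.ne' (by omega) hne hmw.ne' hmp.ne'

/-- The encoder of the augmented code in terms of the parameters of the code: every pair is sent to
a word of weight `n`, `w`, `wp` or `wm`, as prescribed by quadratic characters. -/
theorem exists_weightParameters {F K₁ K₂ K : Type*} [Field F] [Fintype F] [DecidableEq F]
    [Field K₁] [Fintype K₁] [Field K₂] [Fintype K₂] [Field K] [Fintype K]
    [Algebra F K₁] [Algebra F K₂] [Algebra F K] [Algebra K₁ K] [Algebra K₂ K]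
    [IsScalarTower F K₁ K] [IsScalarTower F K₂ K] {q m i j : ℕ}
    (hq : Fintype.card F = q) (hm : Module.finrank F K = m)
    (hm₁ : Module.finrank F K₁ = 2 * i + 1) (hm₂ : Module.finrank F K₂ = 2 * j + 2)
    (he : Nat.gcd (2 * i + 1) (2 * j + 2) = 1) (hl : Nat.gcd (2 * j + 2) (q - 1) = 2)
    (hq3 : 3 ≤ q) :
    ∃ M S w wp wm : ℕ, ∃ η : K₁ → ℤ,
      WeightParameters q m i j M S (definingSet F K₂ K).card w wp wm ∧
      (∀ b, b ≠ 0 → η b = 1 ∨ η b = -1) ∧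
      (∀ c : F, c ≠ 0 → hammingNorm (augmentedEncoder F K₁ (definingSet F K₂ K) (0, c))
        = (definingSet F K₂ K).card) ∧
      (∀ b : K₁, b ≠ 0 →
        hammingNorm (augmentedEncoder F K₁ (definingSet F K₂ K) (b, 0)) = w) ∧
      ∀ (b : K₁) (c : F), b ≠ 0 → c ≠ 0 →
        hammingNorm (augmentedEncoder F K₁ (definingSet F K₂ K) (b, c))
          = if η b * quadraticChar F c = 1 then wp else wm := by
  obtain ⟨M, S, δ, hδ, hM, hS, hn, hW0c, hWb0, hWbc⟩ :=
    exists_weights (F := F) (K₁ := K₁) (K₂ := K₂) (K := K) hq hm₁ hm₂ he hl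
  rw [hm] at hM
  simp only [show 2 * i + 1 - 1 = 2 * i by omega, show 2 * j + 2 - 1 = 2 * j + 1 by omega,
    show (2 * i + 1 + (2 * j + 2) - 3) / 2 = i + j by omega] at hS hWb0 hWbc
  obtain ⟨w, wp, wm, h⟩ := WeightParameters.exists_of_mul_eq hq3
    (hm ▸ Module.finrank_pos) hM hS hn
  have hη : ∀ b : K₁, b ≠ 0 → δ * quadraticChar F (Algebra.norm F b) = 1 ∨
      δ * quadraticChar F (Algebra.norm F b) = -1 := by
    intro b hb
    obtain h | h := quadraticChar_dichotomy (F := F) (a := Algebra.norm F b) (by simpa using hb) <;>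
      obtain h' | h' := hδ <;> rw [h, h'] <;> norm_num
  refine ⟨M, S, w, wp, wm, fun b => δ * quadraticChar F (Algebra.norm F b), h, hη, hW0c,
    fun b hb => ?_, fun b c hb hc => ?_⟩
  · exact_mod_cast (hWb0 b hb).trans h.w_eq.symm
  · have hw := hWbc b c hb hc
    have hs : δ * quadraticChar F (Algebra.norm F b) * quadraticChar F c = 1 ∨
        δ * quadraticChar F (Algebra.norm F b) * quadraticChar F c = -1 := by
      obtain h' | h' := hη b hb <;> obtain h'' | h'' := quadraticChar_dichotomy hc <;>
        rw [h', h''] <;> norm_num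
    obtain hs | hs := hs
    · rw [hs, one_mul, ← h.wp_eq] at hw
      rw [if_pos hs]
      exact_mod_cast hw
    · rw [hs, neg_one_mul, ← sub_eq_add_neg, ← h.wm_eq] at hw
      rw [if_neg (by rw [hs]; norm_num)]
      exact_mod_cast hw

theorem theorem6
    {F K₁ K₂ K : Type*} [Field F] [Fintype F] [DecidableEq F]
    [Field K₁] [Field K₂] [Field K] [Fintype K]
    [Algebra F K₁] [Algebra F K₂] [Algebra F K] [Algebra K₁ K] [Algebra K₂ K]
    [IsScalarTower F K₁ K] [IsScalarTower F K₂ K]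
    (q m m₁ m₂ : ℕ) (hq : Fintype.card F = q)
    (hm : Module.finrank F K = m)
    (hm₁ : Module.finrank F K₁ = m₁) (hm₂ : Module.finrank F K₂ = m₂)
    (he : Nat.gcd m₁ m₂ = 1) (hl : Nat.gcd m₂ (q - 1) = 2) :
    (∃ n w wp wm : ℕ,
      -- the length and the nonzero weights in the table
      (n : ℚ) = ((q : ℚ) ^ m - 1) * ((q : ℚ) ^ m₂ - q) / (q * ((q : ℚ) ^ m₂ - 1)) + 1 ∧
      (w : ℚ) = (q : ℚ) ^ (m₁ - 1) * ((q : ℚ) ^ m - 1) * ((q : ℚ) - 1) *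
          ((q : ℚ) ^ (m₂ - 1) - 1) / (((q : ℚ) ^ m₁ - 1) * ((q : ℚ) ^ m₂ - 1)) ∧
      (wp : ℚ) = ((q : ℚ) ^ m - 1) *
          (((q : ℚ) ^ (m₂ - 1) - 1) * ((q : ℚ) ^ m₁ - (q : ℚ) ^ (m₁ - 1) - 1)
            + ((q : ℚ) - 1) * (q : ℚ) ^ ((m₁ + m₂ - 3) / 2))
          / (((q : ℚ) ^ m₁ - 1) * ((q : ℚ) ^ m₂ - 1)) + 1 ∧
      (wm : ℚ) = ((q : ℚ) ^ m - 1) *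
          (((q : ℚ) ^ (m₂ - 1) - 1) * ((q : ℚ) ^ m₁ - (q : ℚ) ^ (m₁ - 1) - 1)
            - ((q : ℚ) - 1) * (q : ℚ) ^ ((m₁ + m₂ - 3) / 2))
          / (((q : ℚ) ^ m₁ - 1) * ((q : ℚ) ^ m₂ - 1)) + 1 ∧
      -- the length
      (definingSet F K₂ K).card = n ∧
      -- the weight distribution; rows of the table with equal weights are added up
      (∀ j : ℕ, (weightCount (augmentedCode F K₁ (definingSet F K₂ K)) j : ℚ) =
          (if j = 0 then 1 else 0)
          + (if j = n then (q : ℚ) - 1 else 0)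
          + (if j = w then (q : ℚ) ^ m₁ - 1 else 0)
          + (if j = wp then ((q : ℚ) ^ m₁ - 1) * ((q : ℚ) - 1) / 2 else 0)
          + (if j = wm then ((q : ℚ) ^ m₁ - 1) * ((q : ℚ) - 1) / 2 else 0))) ∧
    -- the dimension
    Module.finrank F (augmentedCode F K₁ (definingSet F K₂ K)) = m₁ + 1 ∧
    -- the number of nonzero weights
    ((m₁, m₂) ≠ (1, 2) → IsTWeightCode 4 (augmentedCode F K₁ (definingSet F K₂ K))) ∧
    -- divisibility and self-orthogonality
    (2 ≤ m₁ → 2 ≤ m₂ → 5 ≤ m₁ + m₂ → Odd q →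
      IsDivisibleCode q (augmentedCode F K₁ (definingSet F K₂ K)) ∧
      IsSelfOrthogonalCode (augmentedCode F K₁ (definingSet F K₂ K))) := by
  classical
  have hfin₁ : Finite K₁ := Finite.of_injective _ (algebraMap K₁ K).injective
  have hfin₂ : Finite K₂ := Finite.of_injective _ (algebraMap K₂ K).injective
  have := Fintype.ofFinite K₁
  have := Fintype.ofFinite K₂
  obtain ⟨hq3, ⟨i, rfl⟩, ⟨j, rfl⟩⟩ := three_le_and_parity (hq ▸ Fintype.one_lt_card)
    (hm₂ ▸ Module.finrank_pos) he hl
  have hF : ringChar F ≠ 2 := by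
    intro h2
    have hev : q % 2 = 0 := hq ▸ FiniteField.even_card_iff_char_two.mp h2
    have h2q : 2 ∣ q - 1 := hl ▸ Nat.gcd_dvd_right _ _
    omega
  have hVcard : Fintype.card K₁ = q ^ (2 * i + 1) := by
    rw [← hq, ← hm₁]
    exact Module.card_eq_pow_finrank
  obtain ⟨M, S, w, wp, wm, η, hP, hη, h₁, h₂, h₃⟩ :=
    exists_weightParameters (F := F) (K₁ := K₁) (K₂ := K₂) (K := K) hq hm hm₁ hm₂ he hl hq3
  simp only [show 2 * i + 1 - 1 = 2 * i by omega, show 2 * j + 2 - 1 = 2 * j + 1 by omega,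
    show (2 * i + 1 + (2 * j + 2) - 3) / 2 = i + j by omega]
  rw [← range_augmentedEncoder]
  generalize definingSet F K₂ K = D at *
  set f := augmentedEncoder F K₁ D with hf
  obtain ⟨hn0, hw0, hwm0, hlt⟩ := hP.pos_and_lt
  have hweights : ∀ p : K₁ × F, p ≠ 0 → hammingNorm (f p) = D.card ∨ hammingNorm (f p) = w ∨
      hammingNorm (f p) = wp ∨ hammingNorm (f p) = wm := by
    rintro ⟨b, c⟩ hp
    by_cases hb : b = 0 <;> by_cases hc : c = 0
    · exact absurd (by rw [hb, hc]; rfl) hp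
    · subst hb
      exact Or.inl (h₁ c hc)
    · subst hc
      exact Or.inr (Or.inl (h₂ b hb))
    · rw [h₃ b c hb hc]
      split_ifs <;> simp
  -- Every nonzero pair is sent to a word of positive weight; this yields the dimension and lets
  -- codewords be counted by pairs.
  have hinj : Function.Injective f := by
    rw [injective_iff_map_eq_zero]
    intro p hp
    by_contra hp0
    have h := hweights p hp0
    rw [hp, hammingNorm_zero] at h
    omega
  have hdist := weightCount_eq_of_weights hF f hinj η hη h₁ h₂ h₃
  rw [hq, hVcard, Nat.cast_pow] at hdist
  obtain ⟨r₁, r₂, r₃, r₄⟩ := hP.rat_formulas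
  refine ⟨⟨D.card, w, wp, wm, r₁, r₂, r₃, r₄, rfl, hdist⟩, ?_, ?_, ?_⟩
  · rw [LinearMap.finrank_range_of_inj hinj, Module.finrank_prod, hm₁, Module.finrank_self]
  · intro hne
    have hij : 0 < i + j := by
      by_contra h0
      exact hne (by rw [show i = 0 by omega, show j = 0 by omega])
    obtain ⟨hpn, hwn, hmw, hwp⟩ := hP.lt_and_ne hij
    have hqQ : (3 : ℚ) ≤ q := by exact_mod_cast hq3
    have hpos₁ : (0 : ℚ) < (q : ℚ) - 1 := by linarith
    have hpos₂ : (0 : ℚ) < (q : ℚ) ^ (2 * i + 1) - 1 :=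
      sub_pos.mpr (one_lt_pow₀ (by linarith) (by omega))
    have hpos₃ := half_pos (mul_pos hpos₂ hpos₁)
    exact isTWeightCode_four_of_weightCount hpos₁ hpos₂ hpos₃ hpos₃ (by simp) hwm0 hmw hlt hwn
      hpn hwp hdist
  · intro hm₁' _ _ _
    obtain ⟨d₁, d₂, d₃, d₄⟩ := hP.dvd (by omega)
    have hdiv : ∀ u ∈ LinearMap.range f, q ∣ hammingNorm u := by
      rintro _ ⟨p, rfl⟩
      by_cases hp : p = 0
      · simp [hp]
      · obtain h | h | h | h := hweights p hp <;> rw [h] <;> assumption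
    refine ⟨⟨by omega, hdiv⟩, isSelfOrthogonalCode_of_weights hF _ ?_ ?_⟩
    · intro c
      exact ⟨(0, c), by ext x; simp [hf, augmentedEncoder]⟩
    · intro u hu
      obtain ⟨k, hk⟩ := hdiv u hu
      -- A weight divisible by q = |F| vanishes in F, as the self-orthogonality criterion requires.
      rw [hk, Nat.cast_mul, ← hq, FiniteField.cast_card_eq_zero, zero_mul]
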